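/- **Conventions.** Let $\mathcal C$ be an abelian category with enough projectives. For objects $A,B$ with projective resolutions $A_\bullet\to A$, $B_\bullet\to B$ (extended by $0$ in negative degrees) let $\mathrm{Hyp}(A_\bullet,B_\bullet)^n=\prod_{k}\mathrm{Hom}(A_{k+n},B_k)$ with differential $d^n\varphi=b\circ\varphi-(-1)^n\varphi\circ a$, let $\mathrm{Bdd}^n=\bigoplus_k\mathrm{Hom}(A_{k+n},B_k)$ be the bounded subcomplex, and let $\widehat{\mathrm{Ext}}{}^n(A,B)=H^n(\mathrm{Hyp}/\mathrm{Bdd})$ for $n\in\mathbb Z$ be the completed (unenriched) Ext group. Its elements are classes of almost chain maps, i.e. of cochains whose differential is bounded. Yoneda products $\circ$ are induced by composition of almost chain maps, and $1_A\in\widehat{\mathrm{Ext}}{}^0(A,A)$ is the class of $\mathrm{id}_{A_\bullet}$. The syzygies of $B_\bullet$ are $\widetilde B_0=B$ and $\widetilde B_{k+1}=\ker(B_k\to\widetilde B_k)$. Let $R$ be a ring object and $G$ a group object in a category with finite products, let $Mod_R$ be the category of $R$-module objects and $Mod_R(G)$ the category of $R$-module objects with a compatible action of $G$ (by additive and $R$-linear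 maps); $R$ is regarded as an object of $Mod_R(G)$ with trivial action. Assume that $Mod_R$ and $Mod_R(G)$ are abelian, each with a biadditive monoidal structure $\otimes_R$; that $Mod_R(G)$ has enough projectives, that $P\otimes_RQ$ is projective in it for projective $P,Q$, and that $R$ is isomorphic to its monoidal unit (so that $M\otimes_RR\cong M\cong R\otimes_RM$ naturally); that the restriction functor $Mod_R(G)\to Mod_R$ is exact, strong monoidal and preserves projectives; and that $R$ is projective in $Mod_R$. Call a projective resolution $B_\bullet$ in $Mod_R(G)$ *admissible* if for each of its syzygies $\widetilde B_k$ the functors $-\otimes_R\widetilde B_k$ and $\widetilde B_k\otimes_R-$ on $Mod_R(G)$ are exact and preserve projectives. Fix an admissible projective resolution $R_\bullet$ of $R$. For $M$ with an admissible projective resolution $M_\bullet$ put $\widehat H{}^n_R(G,M)=\widehat{\mathrm{Ext}}{}^n(R,M)$, computed in $Mod_R(G)$ with $R_\bullet$ and $M_\bullet$. Cup products are defined as follows. Fix a sequence of steps, each raising exactly one of two indices $(p,d)$ by $1$, starting at $(0,0)$, with both kinds of steps occurring infinitely often. For admissible $B_\bullet$, $E_\bullet$ let $B_\bullet\otimes^oE_\bullet$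 be the resolution of $B\otimes_RE$ whose $k$-th term is $B_p\otimes\widetilde E_d$, resp. $\widetilde B_p\otimes E_d$, where $(p,d)$ is reached after $k$ steps and the next step raises the first, resp. second, index. It is spliced from the exact sequences $$0\to\widetilde B_{p+1}\otimes\widetilde E_d\to B_p\otimes\widetilde E_d\to\widetilde B_p\otimes\widetilde E_d\to0,\qquad 0\to\widetilde B_p\otimes\widetilde E_{d+1}\to\widetilde B_p\otimes E_d\to\widetilde B_p\otimes\widetilde E_d\to0,$$ the first map of the second sequence carrying the sign $(-1)^p$. For almost chain maps $\varphi\colon R_{\bullet+m}\to B_\bullet$ and $\psi\colon R_{\bullet+n}\to E_\bullet$ of degrees $m,n$ let $\varphi\otimes^o\psi\colon(R_\bullet\otimes_RR_\bullet)_{\bullet+m+n}\to(B_\bullet\otimes^oE_\bullet)_\bullet$ be the almost chain map that in degree $k$ is $(-1)^{(m+p)n}\varphi_{m+p}\otimes\psi_{n+d}$ on the summand $R_{m+p}\otimes R_{n+d}$, followed by the projection onto the $k$-th term, and is $0$ on the other summands. Let $\Delta\colon R_\bullet\to R_\bullet\otimes_RR_\bullet$ be a chain map lifting $R\cong R\otimes_RR$.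 Given a morphism $g\colon B\otimes_RE\to N$ and a chain map $\theta\colon B_\bullet\otimes^oE_\bullet\to N_\bullet$ lifting $g$, the cup product of $[\varphi]$ and $[\psi]$ with values in $\widehat H{}^{m+n}_R(G,N)$ is $[\varphi]\smile[\psi]=[\theta\circ(\varphi\otimes^o\psi)\circ\Delta]$. Below, $g$ is one of the canonical isomorphisms $M\otimes_RR\cong M$ and $R\otimes_RM\cong M$. **Lemma (Cohomology rings).** 1. Let $M$ be any object of $Mod_R(G)$ with an admissible projective resolution. The lifts $\Delta$ and $\theta$ exist, and for every choice of them and every step sequence as above $$x\smile1_R=x=1_R\smile x\qquad\text{for all }n\in\mathbb Z,\ x\in\widehat H{}^n_R(G,M).$$ In particular, cup products turn $\bigoplus_{n\in\mathbb Z}\widehat H{}^n_R(G,R)$ into a graded ring with identity $1_R$. 2. Let $A,B$ be objects of any abelian category $\mathcal C$ with enough projectives. Then for all $n\in\mathbb Z$, $y\in\widehat{\mathrm{Ext}}{}^n_{\mathcal C}(A,B)$ and $z\in\widehat{\mathrm{Ext}}{}^n_{\mathcal C}(B,A)$ $$y\circ1_A=y\quad\text{and}\quad1_A\circ z=z.$$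 In particular, Yoneda products turn $\bigoplus_{n\in\mathbb Z}\widehat{\mathrm{Ext}}{}^n_{\mathcal C}(A,A)$ into a graded ring with identity $1_A$. Here a graded ring is an associative ring with identity on the direct sum, whose multiplication is given by the stated products on homogeneous elements. -/

import Mathlib

open CategoryTheory Limits MonoidalCategory

universe v u t w

namespace CompletedExt

section Cochains

variable {C : Type u} [Category.{v} C] [Preadditive C]

/-- A family of morphisms `A_p ⟶ B_q`, one for each pair of degrees. The complexes live in degrees
`≥ 0`, so nothing is lost by not indexing over the negative degrees, where the terms are zero. -/
abbrev Fam (A B : ChainComplex C ℕ) : Type v := ∀ p q : ℕ, A.X p ⟶ B.X q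

/-- The hypercohomology `n`-cochains `∏_q Hom(A_{q+n}, B_q)`: the families whose only
components are the `A_{q+n} ⟶ B_q`. -/
def cochains (A B : ChainComplex C ℕ) (n : ℤ) : AddSubgroup (Fam A B) where
  carrier := {φ | ∀ p q : ℕ, (p : ℤ) ≠ q + n → φ p q = 0}
  zero_mem' := fun _ _ _ => rfl
  add_mem' := fun {φ ψ} hφ hψ p q h => by
    change φ p q + ψ p q = 0
    rw [hφ p q h, hψ p q h, add_zero]
  neg_mem' := fun {φ} hφ p q h => by
    change -φ p q = 0
    rw [hφ p q h, neg_zero]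

/-- The families with `φ p q = 0` for all large `q`. Inside the `n`-cochains, where `p = q + n`,
these are the families with finitely many nonzero components, that is `⨁_q Hom(A_{q+n}, B_q)`. -/
def bounded (A B : ChainComplex C ℕ) : AddSubgroup (Fam A B) where
  carrier := {φ | ∃ N : ℕ, ∀ p q : ℕ, N ≤ q → φ p q = 0}
  zero_mem' := ⟨0, fun _ _ _ => rfl⟩
  add_mem' := by
    rintro φ ψ ⟨N, hN⟩ ⟨N', hN'⟩
    refine ⟨max N N', fun p q h => ?_⟩
    change φ p q + ψ p q = 0
    rw [hN p q (le_trans (le_max_left _ _) h), hN' p q (le_trans (le_max_right _ _) h), add_zero]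
  neg_mem' := by
    rintro φ ⟨N, hN⟩
    refine ⟨N, fun p q h => ?_⟩
    change -φ p q = 0
    rw [hN p q h, neg_zero]

/-- The differential `φ ↦ b ∘ φ - (-1)ⁿ φ ∘ a` of the hypercohomology complex in degree `n`.
For `p = 0` the second term vanishes, because `A.d 0 0 = 0`. -/
def diff (A B : ChainComplex C ℕ) (n : ℤ) : Fam A B →+ Fam A B :=
  AddMonoidHom.mk'
    (fun φ p q => φ p (q + 1) ≫ B.d (q + 1) q - n.negOnePow • (A.d p (p - 1) ≫ φ (p - 1) q))
    (fun φ ψ => by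
      funext p q
      simp only [Pi.add_apply, Preadditive.add_comp, Preadditive.comp_add, smul_add]
      abel)

/-- The `n`-cochains whose differential is bounded (almost chain maps): they represent the
`n`-cocycles of the quotient complex hypercohomology modulo bounded. -/
def almostCocycles (A B : ChainComplex C ℕ) (n : ℤ) : AddSubgroup (Fam A B) :=
  cochains A B n ⊓ (bounded A B).comap (diff A B n)

/-- The `n`-cochains that are the sum of a coboundary and a bounded family: they represent the
`n`-coboundaries of the quotient complex hypercohomology modulo bounded. -/
def almostCoboundaries (A B : ChainComplex C ℕ) (n : ℤ) : AddSubgroup (Fam A B) :=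
  cochains A B n ⊓ ((cochains A B (n - 1)).map (diff A B (n - 1)) ⊔ bounded A B)

/-- The `n`-th cohomology of the Vogel complex, the quotient of the hypercohomology complex of
`A` and `B` by its bounded subcomplex. If `A` and `B` are projective resolutions of two objects,
this is their completed (unenriched) Ext group of degree `n`. -/
abbrev CExt (n : ℤ) (A B : ChainComplex C ℕ) : Type v :=
  almostCocycles A B n ⧸ (almostCoboundaries A B n).addSubgroupOf (almostCocycles A B n)

/-- The class of an almost chain map. -/
def CExt.mk {A B : ChainComplex C ℕ} {n : ℤ} (φ : Fam A B) (hφ : φ ∈ almostCocycles A B n) :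
    CExt n A B :=
  QuotientAddGroup.mk ⟨φ, hφ⟩

variable {A B D : ChainComplex C ℕ}

lemma diff_apply (n : ℤ) (φ : Fam A B) (p q : ℕ) :
    diff A B n φ p q =
      φ p (q + 1) ≫ B.d (q + 1) q - n.negOnePow • (A.d p (p - 1) ≫ φ (p - 1) q) := rfl

lemma d_zero_zero (A : ChainComplex C ℕ) : A.d 0 (0 - 1) = 0 :=
  A.shape _ _ (by simp)

lemma diff_mem_cochains {n : ℤ} {φ : Fam A B} (hφ : φ ∈ cochains A B n) :
    diff A B n φ ∈ cochains A B (n + 1) := by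
  intro p q h
  rw [diff_apply, hφ p (q + 1) (by push_cast; lia), zero_comp, zero_sub, neg_eq_zero]
  rcases p with _ | p
  · rw [d_zero_zero, zero_comp, smul_zero]
  · rw [Nat.add_sub_cancel, hφ p q (by push_cast at h; lia), comp_zero, smul_zero]

lemma diff_mem_bounded {n : ℤ} {φ : Fam A B} (hφ : φ ∈ bounded A B) :
    diff A B n φ ∈ bounded A B := by
  obtain ⟨N, hN⟩ := hφ
  refine ⟨N, fun p q h => ?_⟩
  rw [diff_apply, hN _ _ (by lia), hN _ _ h, zero_comp, comp_zero, smul_zero, sub_zero]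

lemma diff_diff (n : ℤ) (φ : Fam A B) : diff A B (n + 1) (diff A B n φ) = 0 := by
  funext p q
  simp only [diff_apply, Pi.zero_apply, Preadditive.sub_comp, Preadditive.comp_sub,
    Category.assoc, HomologicalComplex.d_comp_d, comp_zero, Int.negOnePow_succ,
    Linear.units_smul_comp, Linear.comp_units_smul, HomologicalComplex.d_comp_d_assoc, zero_comp,
    smul_zero, zero_sub, sub_zero, Units.neg_smul]
  abel

lemma diff_mem_almostCocycles {n : ℤ} {φ : Fam A B} (hφ : φ ∈ cochains A B (n - 1)) :
    diff A B (n - 1) φ ∈ almostCocycles A B n := by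
  refine ⟨by simpa using diff_mem_cochains hφ, ?_⟩
  have h := diff_diff (n - 1) φ
  rw [sub_add_cancel] at h
  change diff A B n (diff A B (n - 1) φ) ∈ bounded A B
  rw [h]
  exact zero_mem _

/-- The composite `ψ ∘ φ` of families, where `ψ` has degree `n`: the component `A_p ⟶ D_r` goes
through `B_{r+n}`. (If `r + n < 0`, then `ψ` has no component into `D_r`; for `ψ` in
`cochains B D n` the value is zero.) -/
def comp (n : ℤ) : Fam B D →+ Fam A B →+ Fam A D :=
  AddMonoidHom.mk'
    (fun ψ => AddMonoidHom.mk'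
      (fun φ p r => φ p ((r : ℤ) + n).toNat ≫ ψ ((r : ℤ) + n).toNat r)
      (fun φ φ' => by
        funext p r
        simp only [Pi.add_apply, Preadditive.add_comp]))
    (fun ψ ψ' => by
      refine AddMonoidHom.ext fun φ => funext fun p => funext fun r => ?_
      exact Preadditive.comp_add _ _ _ _ _ _)

lemma comp_apply (n : ℤ) (ψ : Fam B D) (φ : Fam A B) (p r : ℕ) :
    comp n ψ φ p r = φ p ((r : ℤ) + n).toNat ≫ ψ ((r : ℤ) + n).toNat r := rfl

lemma comp_mem_cochains {m n k : ℤ} (h : n + m = k) {ψ : Fam B D} {φ : Fam A B}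
    (hψ : ψ ∈ cochains B D n) (hφ : φ ∈ cochains A B m) : comp n ψ φ ∈ cochains A D k := by
  intro p r hp
  rw [comp_apply]
  by_cases h0 : 0 ≤ (r : ℤ) + n
  · rw [hφ p _ (by lia), zero_comp]
  · rw [hψ _ r (by lia), comp_zero]

lemma comp_mem_bounded_left {n : ℤ} {ψ : Fam B D} (φ : Fam A B)
    (hψ : ψ ∈ bounded B D) : comp n ψ φ ∈ bounded A D := by
  obtain ⟨N, hN⟩ := hψ
  exact ⟨N, fun p r h => by rw [comp_apply, hN _ _ h, comp_zero]⟩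

lemma comp_mem_bounded_right {n : ℤ} (ψ : Fam B D) {φ : Fam A B}
    (hφ : φ ∈ bounded A B) : comp n ψ φ ∈ bounded A D := by
  obtain ⟨N, hN⟩ := hφ
  exact ⟨N + n.natAbs, fun p r h => by rw [comp_apply, hN _ _ (by lia), zero_comp]⟩

lemma diff_comp {m n k : ℤ} (h : n + m = k) {ψ : Fam B D} (hψ : ψ ∈ cochains B D n)
    (φ : Fam A B) :
    diff A D k (comp n ψ φ) =
      comp (n + 1) (diff B D n ψ) φ + n.negOnePow • comp n ψ (diff A B m φ) := by
  subst h
  funext p r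
  have e : (((r + 1 : ℕ) : ℤ) + n) = (r : ℤ) + (n + 1) := by push_cast; ring
  have key : φ p ((r : ℤ) + (n + 1)).toNat ≫
        B.d ((r : ℤ) + (n + 1)).toNat (((r : ℤ) + (n + 1)).toNat - 1) ≫
          ψ (((r : ℤ) + (n + 1)).toNat - 1) r =
      φ p (((r : ℤ) + n).toNat + 1) ≫ B.d (((r : ℤ) + n).toNat + 1) ((r : ℤ) + n).toNat ≫
        ψ ((r : ℤ) + n).toNat r := by
    by_cases h0 : 0 ≤ (r : ℤ) + n
    · have : ((r : ℤ) + (n + 1)).toNat = ((r : ℤ) + n).toNat + 1 := by lia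
      rw [this, Nat.add_sub_cancel]
    · have h1 : ((r : ℤ) + (n + 1)).toNat = 0 := by lia
      rw [h1, d_zero_zero, zero_comp, comp_zero, hψ _ r (by lia), comp_zero, comp_zero]
  have e' : φ p (((r + 1 : ℕ) : ℤ) + n).toNat ≫ ψ (((r + 1 : ℕ) : ℤ) + n).toNat (r + 1) =
      φ p ((r : ℤ) + (n + 1)).toNat ≫ ψ ((r : ℤ) + (n + 1)).toNat (r + 1) := by rw [e]
  have e'' := congrArg (· ≫ D.d (r + 1) r) e'
  simp only [Category.assoc] at e''
  simp only [Pi.add_apply, Pi.smul_apply, diff_apply, comp_apply, e'', Preadditive.comp_sub,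
    Preadditive.sub_comp, Linear.comp_units_smul, Linear.units_smul_comp, Category.assoc, key,
    Int.negOnePow_add, mul_smul, smul_sub]
  abel


/-- The biadditive map on subquotients induced by a biadditive map. -/
def quotientMap₂ {X Y W : Type*} [AddCommGroup X] [AddCommGroup Y] [AddCommGroup W]
    {X₁ X₀ : AddSubgroup X} {Y₁ Y₀ : AddSubgroup Y} {W₁ W₀ : AddSubgroup W} (f : X →+ Y →+ W)
    (h : ∀ x ∈ X₁, ∀ y ∈ Y₁, f x y ∈ W₁)
    (hl : ∀ x ∈ X₁, x ∈ X₀ → ∀ y ∈ Y₁, f x y ∈ W₀)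
    (hr : ∀ x ∈ X₁, ∀ y ∈ Y₁, y ∈ Y₀ → f x y ∈ W₀) :
    (X₁ ⧸ X₀.addSubgroupOf X₁) →+ (Y₁ ⧸ Y₀.addSubgroupOf Y₁) →+ (W₁ ⧸ W₀.addSubgroupOf W₁) :=
  QuotientAddGroup.lift _
    (AddMonoidHom.mk'
      (fun x => QuotientAddGroup.map _ _
        (AddMonoidHom.mk' (fun y : Y₁ => (⟨f x y, h x x.2 y y.2⟩ : W₁))
          (fun y y' => Subtype.ext (map_add (f x) (y : Y) y')))
        (fun y hy => hr x x.2 y y.2 hy))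
      (fun x x' => by
        refine QuotientAddGroup.addMonoidHom_ext _ (AddMonoidHom.ext fun y => ?_)
        exact congrArg (QuotientAddGroup.mk (s := W₀.addSubgroupOf W₁))
          (Subtype.ext (by simp))))
    (fun x hx => by
      refine QuotientAddGroup.addMonoidHom_ext _ (AddMonoidHom.ext fun y => ?_)
      exact (QuotientAddGroup.eq_zero_iff _).2 (hl x x.2 hx y y.2))

lemma comp_mem_almostCocycles {m n k : ℤ} (h : n + m = k) {ψ : Fam B D} {φ : Fam A B}
    (hψ : ψ ∈ almostCocycles B D n) (hφ : φ ∈ almostCocycles A B m) :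
    comp n ψ φ ∈ almostCocycles A D k := by
  refine ⟨comp_mem_cochains h hψ.1 hφ.1, ?_⟩
  change diff A D k (comp n ψ φ) ∈ bounded A D
  rw [diff_comp h hψ.1]
  refine add_mem (comp_mem_bounded_left φ hψ.2) ?_
  have := comp_mem_bounded_right (n := n) ψ hφ.2
  rcases Int.units_eq_one_or n.negOnePow with e | e <;> rw [e]
  · rwa [one_smul]
  · rw [Units.neg_smul, one_smul]; exact neg_mem this

lemma comp_mem_almostCoboundaries_left {m n k : ℤ} (h : n + m = k) {ψ : Fam B D} {φ : Fam A B}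
    (hψ : ψ ∈ almostCoboundaries B D n) (hφ : φ ∈ almostCocycles A B m) :
    comp n ψ φ ∈ almostCoboundaries A D k := by
  refine ⟨comp_mem_cochains h hψ.1 hφ.1, ?_⟩
  obtain ⟨_, ⟨χ, hχ, rfl⟩, β, hβ, rfl⟩ := AddSubgroup.mem_sup.1 hψ.2
  rw [map_add, AddMonoidHom.add_apply]
  refine add_mem ?_ (AddSubgroup.mem_sup_right (comp_mem_bounded_left φ hβ))
  have e := diff_comp (m := m) (n := n - 1) (k := k - 1) (by lia) hχ φ
  rw [sub_add_cancel] at e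
  have hc : comp (n - 1) χ φ ∈ cochains A D (k - 1) := comp_mem_cochains (by lia) hχ hφ.1
  rw [← sub_eq_iff_eq_add.2 e]
  refine AddSubgroup.sub_mem _ (AddSubgroup.mem_sup_left ⟨_, hc, rfl⟩)
    (AddSubgroup.mem_sup_right ?_)
  have := comp_mem_bounded_right (n := n - 1) χ hφ.2
  rcases Int.units_eq_one_or (n - 1).negOnePow with e | e <;> rw [e]
  · rwa [one_smul]
  · rw [Units.neg_smul, one_smul]; exact neg_mem this

lemma comp_mem_almostCoboundaries_right {m n k : ℤ} (h : n + m = k) {ψ : Fam B D} {φ : Fam A B}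
    (hψ : ψ ∈ almostCocycles B D n) (hφ : φ ∈ almostCoboundaries A B m) :
    comp n ψ φ ∈ almostCoboundaries A D k := by
  refine ⟨comp_mem_cochains h hψ.1 hφ.1, ?_⟩
  obtain ⟨_, ⟨χ, hχ, rfl⟩, β, hβ, rfl⟩ := AddSubgroup.mem_sup.1 hφ.2
  rw [map_add]
  refine add_mem ?_ (AddSubgroup.mem_sup_right (comp_mem_bounded_right ψ hβ))
  have e := diff_comp (m := m - 1) (n := n) (k := k - 1) (by lia) hψ.1 χ
  have hc : comp n ψ χ ∈ cochains A D (k - 1) := comp_mem_cochains (by lia) hψ.1 hχ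
  have h1 : n.negOnePow • comp n ψ (diff A B (m - 1) χ) ∈
      (cochains A D (k - 1)).map (diff A D (k - 1)) ⊔ bounded A D := by
    rw [← sub_eq_iff_eq_add'.2 e]
    exact sub_mem (AddSubgroup.mem_sup_left ⟨_, hc, rfl⟩)
      (AddSubgroup.mem_sup_right (comp_mem_bounded_left χ hψ.2))
  rcases Int.units_eq_one_or n.negOnePow with e | e <;> rw [e] at h1
  · rwa [one_smul] at h1
  · rw [Units.neg_smul, one_smul] at h1; simpa using neg_mem h1

/-- The Yoneda product `y ∘ x`, induced by the composition of almost chain maps. -/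
def yoneda {m n k : ℤ} (h : n + m = k) : CExt n B D →+ CExt m A B →+ CExt k A D :=
  quotientMap₂ (comp n) (fun _ hψ _ hφ => comp_mem_almostCocycles h hψ hφ)
    (fun _ _ hψ _ hφ => comp_mem_almostCoboundaries_left h hψ hφ)
    (fun _ hψ _ _ hφ => comp_mem_almostCoboundaries_right h hψ hφ)

/-- A chain map as a family of degree `0`. -/
def homFam (f : A ⟶ B) : Fam A B := fun p q =>
  if h : p = q then f.f p ≫ eqToHom (congrArg B.X h) else 0

lemma homFam_self (f : A ⟶ B) (p : ℕ) : homFam f p p = f.f p := by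
  simp [homFam]

lemma homFam_of_ne (f : A ⟶ B) {p q : ℕ} (h : p ≠ q) : homFam f p q = 0 :=
  dif_neg h

lemma diff_homFam (f : A ⟶ B) : diff A B 0 (homFam f) = 0 := by
  funext p q
  rw [diff_apply, Int.negOnePow_zero, one_smul]
  by_cases h : p = q + 1
  · subst h
    rw [homFam_self, Nat.add_sub_cancel, homFam_self, f.comm, sub_self, Pi.zero_apply,
      Pi.zero_apply]
  · rw [homFam_of_ne f h, zero_comp, zero_sub]
    rcases p with _ | p
    · rw [d_zero_zero, zero_comp, neg_zero]; rfl
    · rw [Nat.add_sub_cancel, homFam_of_ne f (by lia), comp_zero, neg_zero]; rfl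

lemma homFam_mem_almostCocycles (f : A ⟶ B) : homFam f ∈ almostCocycles A B 0 := by
  refine ⟨fun p q h => homFam_of_ne f (by lia), ?_⟩
  change diff A B 0 (homFam f) ∈ bounded A B
  rw [diff_homFam]
  exact zero_mem _

/-- The class of a chain map in degree `0`. -/
def ofHom (f : A ⟶ B) : CExt 0 A B := CExt.mk (homFam f) (homFam_mem_almostCocycles f)

end Cochains

section Syzygies

variable {C : Type u} [Category.{v} C] [Abelian C] {M : C}


/-- The target of the `k`-th map of the augmented resolution `⋯ → P₁ → P₀ → M`. -/
noncomputable def prevObj (P : ProjectiveResolution M) : ℕ → C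
  | 0 => M
  | k + 1 => P.complex.X k

/-- The maps of the augmented resolution `⋯ → P₁ → P₀ → M`. -/
noncomputable def augD (P : ProjectiveResolution M) : ∀ k : ℕ, P.complex.X k ⟶ prevObj P k
  | 0 => P.π.f 0
  | k + 1 => P.complex.d (k + 1) k

lemma d_augD (P : ProjectiveResolution M) (k : ℕ) : P.complex.d (k + 1) k ≫ augD P k = 0 := by
  rcases k with _ | k
  · exact P.complex_d_comp_π_f_zero
  · exact P.complex.d_comp_d _ _ _

/-- The syzygies of a projective resolution of `M`: the `0`-th is `M`, the `k+1`-st is the kernel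
of `P_k ⟶ P_{k-1}` (of the augmentation `P₀ ⟶ M` if `k = 0`), which is also the kernel of the
epimorphism from `P_k` to the `k`-th syzygy. -/
noncomputable def syzygy (P : ProjectiveResolution M) : ℕ → C
  | 0 => M
  | k + 1 => kernel (augD P k)

/-- The inclusion of the `k+1`-st syzygy into `P_k`. -/
noncomputable def syzygyι (P : ProjectiveResolution M) (k : ℕ) :
    syzygy P (k + 1) ⟶ P.complex.X k :=
  kernel.ι (augD P k)

/-- The epimorphism from `P_k` onto the `k`-th syzygy. -/
noncomputable def syzygyπ (P : ProjectiveResolution M) : ∀ k : ℕ, P.complex.X k ⟶ syzygy P k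
  | 0 => P.π.f 0
  | k + 1 => kernel.lift (augD P k) (P.complex.d (k + 1) k) (d_augD P k)

lemma syzygyπ_ι (P : ProjectiveResolution M) (k : ℕ) :
    syzygyπ P (k + 1) ≫ syzygyι P k = P.complex.d (k + 1) k :=
  kernel.lift_ι _ _ _

lemma syzygyι_π (P : ProjectiveResolution M) (k : ℕ) : syzygyι P k ≫ syzygyπ P k = 0 := by
  rcases k with _ | k
  · exact kernel.condition _
  · have : Mono (syzygyι P k) := inferInstanceAs (Mono (kernel.ι (augD P k)))
    rw [← cancel_mono (syzygyι P k), Category.assoc, syzygyπ_ι, zero_comp]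
    exact kernel.condition _

lemma d_syzygyπ (P : ProjectiveResolution M) (k : ℕ) :
    P.complex.d (k + 1) k ≫ syzygyπ P k = 0 := by
  rw [← syzygyπ_ι, Category.assoc, syzygyι_π, comp_zero]

end Syzygies

section Unit

variable {C : Type u} [Category.{v} C] [Abelian C] {A : C}

/-- The class `1_A` in the completed Ext group of degree `0` of `A` with itself: the class of the
identity of a projective resolution. -/
noncomputable def unitClass (P : ProjectiveResolution A) : CExt 0 P.complex P.complex :=
  ofHom (𝟙 P.complex)

end Unit

section Tensor

variable {C : Type u} [Category.{v} C] [Abelian C] [MonoidalCategory C] [MonoidalPreadditive C]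

/-- The tensor product of two complexes, with differential `a ⊗ id + (-1)ⁱ id ⊗ c` on
`A_i ⊗ C_j`. -/
noncomputable abbrev tensorComplex (A D : ChainComplex C ℕ) : ChainComplex C ℕ :=
  HomologicalComplex.tensorObj A D

/-- The morphism out of the degree `s` term of a tensor product of complexes with given components
on the summands `A_i ⊗ D_j`, `i + j = s`. -/
noncomputable def tensorDesc {A D : ChainComplex C ℕ} {Y : C}
    (f : ∀ i j : ℕ, A.X i ⊗ D.X j ⟶ Y) (s : ℕ) : (tensorComplex A D).X s ⟶ Y :=
  HomologicalComplex.mapBifunctorDesc (fun i j _ => f i j)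

lemma ι_tensorDesc {A D : ChainComplex C ℕ} {Y : C} (f : ∀ i j : ℕ, A.X i ⊗ D.X j ⟶ Y)
    (i j s : ℕ) (h : i + j = s) :
    HomologicalComplex.ιTensorObj A D i j s h ≫ tensorDesc f s = f i j :=
  HomologicalComplex.ι_mapBifunctorDesc _ i j h

lemma tensor_hom_ext {A D : ChainComplex C ℕ} {Y : C} {s : ℕ} {f g : (tensorComplex A D).X s ⟶ Y}
    (h : ∀ i j (h : i + j = s), HomologicalComplex.ιTensorObj A D i j s h ≫ f =
      HomologicalComplex.ιTensorObj A D i j s h ≫ g) : f = g :=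
  HomologicalComplex.mapBifunctor.hom_ext h

lemma d_tensorDesc {A D : ChainComplex C ℕ} {Y : C} (f : ∀ i j : ℕ, A.X i ⊗ D.X j ⟶ Y)
    (s : ℕ) :
    (tensorComplex A D).d s (s - 1) ≫ tensorDesc f (s - 1) =
      tensorDesc (fun i j => (A.d i (i - 1) ▷ D.X j) ≫ f (i - 1) j +
        (i : ℤ).negOnePow • ((A.X i ◁ D.d j (j - 1)) ≫ f i (j - 1))) s := by
  refine tensor_hom_ext fun i j h => ?_
  rw [ι_tensorDesc, HomologicalComplex.mapBifunctor.d_eq, Preadditive.add_comp,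
    Preadditive.comp_add]
  congr 1
  · rw [← Category.assoc]
    erw [HomologicalComplex.mapBifunctor.ι_D₁]
    rcases i with _ | i
    · rw [HomologicalComplex.mapBifunctor.d₁_eq_zero _ _ _ _ _ _ _ (by simp), d_zero_zero]
      simp
    · erw [HomologicalComplex.mapBifunctor.d₁_eq _ _ _ _ (show (ComplexShape.down ℕ).Rel (i + 1) i
        from rfl) j (s - 1) (show i + j = s - 1 by lia)]
      change ((1 : ℤˣ) • (A.d (i + 1) i ▷ D.X j ≫
        HomologicalComplex.ιTensorObj A D i j (s - 1) (by lia))) ≫ _ = _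
      rw [one_smul, Category.assoc, ι_tensorDesc]
      rfl
  · rw [← Category.assoc]
    erw [HomologicalComplex.mapBifunctor.ι_D₂]
    rcases j with _ | j
    · rw [HomologicalComplex.mapBifunctor.d₂_eq_zero _ _ _ _ _ _ _ (by simp), d_zero_zero]
      simp
    · erw [HomologicalComplex.mapBifunctor.d₂_eq _ _ _ _ i
        (show (ComplexShape.down ℕ).Rel (j + 1) j from rfl) (s - 1) (show i + j = s - 1 by lia)]
      change ((-1 : ℤˣ) ^ i • (A.X i ◁ D.d (j + 1) j ≫
        HomologicalComplex.ιTensorObj A D i j (s - 1) (by lia))) ≫ _ = _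
      rw [Linear.units_smul_comp, Category.assoc, ι_tensorDesc, ← zpow_natCast]
      rfl


variable {M N : C}

/-- A step `true` raises the first index. -/
def pStep (b : Bool) (p : ℕ) : ℕ := match b with
  | true => p + 1
  | false => p

/-- A step `false` raises the second index. -/
def dStep (b : Bool) (d : ℕ) : ℕ := match b with
  | true => d
  | false => d + 1

/-- The number of steps among the first `k` that raise the first index. -/
def pCount (o : ℕ → Bool) : ℕ → ℕ
  | 0 => 0
  | k + 1 => pStep (o k) (pCount o k)

/-- The number of steps among the first `k` that raise the second index. -/
def dCount (o : ℕ → Bool) : ℕ → ℕ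
  | 0 => 0
  | k + 1 => dStep (o k) (dCount o k)

/-- `P_p ⊗ Q̃_d` or `P̃_p ⊗ Q_d`, according to the step taken from `(p, d)`, where the tilde
denotes syzygies. -/
noncomputable def stepX (P : ProjectiveResolution M) (Q : ProjectiveResolution N) (b : Bool)
    (p d : ℕ) : C := match b with
  | true => P.complex.X p ⊗ syzygy Q d
  | false => syzygy P p ⊗ Q.complex.X d

/-- The projection of `P_p ⊗ Q_d` to `P_p ⊗ Q̃_d`, resp. `P̃_p ⊗ Q_d`. -/
noncomputable def stepQuot (P : ProjectiveResolution M) (Q : ProjectiveResolution N) (b : Bool)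
    (p d : ℕ) : P.complex.X p ⊗ Q.complex.X d ⟶ stepX P Q b p d := match b with
  | true => P.complex.X p ◁ syzygyπ Q d
  | false => syzygyπ P p ▷ Q.complex.X d

/-- The projection of `P_p ⊗ Q̃_d`, resp. `P̃_p ⊗ Q_d`, to `P̃_p ⊗ Q̃_d`. -/
noncomputable def stepπ (P : ProjectiveResolution M) (Q : ProjectiveResolution N) (b : Bool)
    (p d : ℕ) : stepX P Q b p d ⟶ syzygy P p ⊗ syzygy Q d := match b with
  | true => syzygyπ P p ▷ syzygy Q d
  | false => syzygy P p ◁ syzygyπ Q d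

/-- The inclusion of `P̃_{p+1} ⊗ Q̃_d` into `P_p ⊗ Q̃_d`, resp. of `P̃_p ⊗ Q̃_{d+1}` into
`P̃_p ⊗ Q_d`, the latter with the usual sign `(-1)ᵖ` of a differential on the second factor. -/
noncomputable def stepι (P : ProjectiveResolution M) (Q : ProjectiveResolution N) (b : Bool)
    (p d : ℕ) : syzygy P (pStep b p) ⊗ syzygy Q (dStep b d) ⟶ stepX P Q b p d := match b with
  | true => syzygyι P p ▷ syzygy Q d
  | false => (p : ℤ).negOnePow • (syzygy P p ◁ syzygyι Q d)

lemma stepι_π (P : ProjectiveResolution M) (Q : ProjectiveResolution N) (b : Bool) (p d : ℕ) :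
    stepι P Q b p d ≫ stepπ P Q b p d = 0 := by
  cases b
  · change ((p : ℤ).negOnePow • (syzygy P p ◁ syzygyι Q d)) ≫ syzygy P p ◁ syzygyπ Q d = 0
    rw [Linear.units_smul_comp, ← MonoidalCategory.whiskerLeft_comp, syzygyι_π,
      MonoidalPreadditive.whiskerLeft_zero, smul_zero]
  · change syzygyι P p ▷ syzygy Q d ≫ syzygyπ P p ▷ syzygy Q d = 0
    rw [← MonoidalCategory.comp_whiskerRight, syzygyι_π, MonoidalPreadditive.zero_whiskerRight]

/-- The `k`-th syzygy `P̃_p ⊗ Q̃_d` of the resolution below, `(p, d)` being reached after `k`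
steps. -/
noncomputable abbrev pathSyzygy (o : ℕ → Bool) (P : ProjectiveResolution M)
    (Q : ProjectiveResolution N) (k : ℕ) : C :=
  syzygy P (pCount o k) ⊗ syzygy Q (dCount o k)

/-- The `k`-th term of the resolution below. -/
noncomputable def pathX (o : ℕ → Bool) (P : ProjectiveResolution M)
    (Q : ProjectiveResolution N) (k : ℕ) : C :=
  stepX P Q (o k) (pCount o k) (dCount o k)

/-- The projection of `P_p ⊗ Q_d` to the `k`-th term, `(p, d)` being reached after `k` steps. -/
noncomputable def pathQuot (o : ℕ → Bool) (P : ProjectiveResolution M)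
    (Q : ProjectiveResolution N) (k : ℕ) :
    P.complex.X (pCount o k) ⊗ Q.complex.X (dCount o k) ⟶ pathX o P Q k :=
  stepQuot P Q (o k) (pCount o k) (dCount o k)

/-- The projection of the `k`-th term to the `k`-th syzygy. -/
noncomputable def pathπ (o : ℕ → Bool) (P : ProjectiveResolution M)
    (Q : ProjectiveResolution N) (k : ℕ) : pathX o P Q k ⟶ pathSyzygy o P Q k :=
  stepπ P Q (o k) (pCount o k) (dCount o k)

/-- The inclusion of the `k+1`-st syzygy in the `k`-th term. -/
noncomputable def pathι (o : ℕ → Bool) (P : ProjectiveResolution M)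
    (Q : ProjectiveResolution N) (k : ℕ) : pathSyzygy o P Q (k + 1) ⟶ pathX o P Q k :=
  stepι P Q (o k) (pCount o k) (dCount o k)

lemma pathι_π (o : ℕ → Bool) (P : ProjectiveResolution M) (Q : ProjectiveResolution N) (k : ℕ) :
    pathι o P Q k ≫ pathπ o P Q k = 0 :=
  stepι_π P Q (o k) (pCount o k) (dCount o k)

/-- The complex `P ⊗ᵒ Q` attached to a sequence of steps `o`. Its `k`-th term is `P_p ⊗ Q̃_d` if
the step after `(p, d)` raises the first index, and `P̃_p ⊗ Q_d` if it raises the second one,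
where `(p, d)` is reached after `k` steps. It is spliced from the sequences
`0 ⟶ P̃_{p+1} ⊗ Q̃_d ⟶ P_p ⊗ Q̃_d ⟶ P̃_p ⊗ Q̃_d ⟶ 0` and
`0 ⟶ P̃_p ⊗ Q̃_{d+1} ⟶ P̃_p ⊗ Q_d ⟶ P̃_p ⊗ Q̃_d ⟶ 0`. -/
noncomputable def pathComplex (o : ℕ → Bool) (P : ProjectiveResolution M)
    (Q : ProjectiveResolution N) : ChainComplex C ℕ :=
  ChainComplex.of (pathX o P Q) (fun k => pathπ o P Q (k + 1) ≫ pathι o P Q k)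
    (fun k => by
      rw [Category.assoc, reassoc_of% (pathι_π o P Q (k + 1)), zero_comp, comp_zero])

lemma pathComplex_d (o : ℕ → Bool) (P : ProjectiveResolution M)
    (Q : ProjectiveResolution N) (k : ℕ) :
    (pathComplex o P Q).d (k + 1) k = pathπ o P Q (k + 1) ≫ pathι o P Q k :=
  ChainComplex.of_d (pathX o P Q) (fun k => pathπ o P Q (k + 1) ≫ pathι o P Q k) k

/-- The component on `A_i ⊗ D_j` of the product `φ ⊗ᵒ ψ` in degree `k`, where `ψ` has degree `n`:
the tensor product `φ ⊗ ψ : A_i ⊗ D_j ⟶ P_p ⊗ Q_d` with the Koszul sign `(-1)^{i n}`, followed by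
the projection to `P_p ⊗ Q̃_d`, resp. `P̃_p ⊗ Q_d`. If `φ` and `ψ` are homogeneous of degrees `m`
and `n`, only the summand with `i = p + m`, `j = d + n` contributes. -/
noncomputable def extTerm (o : ℕ → Bool) {A D : ChainComplex C ℕ} (P : ProjectiveResolution M)
    (Q : ProjectiveResolution N) (n : ℤ) (φ : Fam A P.complex) (ψ : Fam D Q.complex) (k i j : ℕ) :
    A.X i ⊗ D.X j ⟶ pathX o P Q k :=
  ((i : ℤ) * n).negOnePow • ((φ i (pCount o k) ⊗ₘ ψ j (dCount o k)) ≫ pathQuot o P Q k)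

/-- The product `φ ⊗ᵒ ψ` of families, where `ψ` has degree `n`. -/
noncomputable def extFam (o : ℕ → Bool) {A D : ChainComplex C ℕ} (P : ProjectiveResolution M)
    (Q : ProjectiveResolution N) (n : ℤ) :
    Fam A P.complex →+ Fam D Q.complex →+ Fam (tensorComplex A D) (pathComplex o P Q) :=
  AddMonoidHom.mk'
    (fun φ => AddMonoidHom.mk'
      (fun ψ s k => tensorDesc (extTerm o P Q n φ ψ k) s)
      (fun ψ ψ' => by
        refine funext fun s => funext fun k => tensor_hom_ext fun i j h => ?_
        change _ = _ ≫ (tensorDesc (extTerm o P Q n φ ψ k) s +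
          tensorDesc (extTerm o P Q n φ ψ' k) s)
        rw [Preadditive.comp_add, ι_tensorDesc, ι_tensorDesc, ι_tensorDesc]
        simp only [extTerm, Pi.add_apply, MonoidalPreadditive.tensor_add, Preadditive.add_comp,
          smul_add]))
    (fun φ φ' => by
      refine AddMonoidHom.ext fun ψ => ?_
      refine funext fun s => funext fun k => tensor_hom_ext fun i j h => ?_
      change _ ≫ tensorDesc (extTerm o P Q n (φ + φ') ψ k) s =
        _ ≫ (tensorDesc (extTerm o P Q n φ ψ k) s + tensorDesc (extTerm o P Q n φ' ψ k) s)
      rw [Preadditive.comp_add, ι_tensorDesc, ι_tensorDesc, ι_tensorDesc]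
      simp only [extTerm, Pi.add_apply, MonoidalPreadditive.add_tensor, Preadditive.add_comp,
        smul_add])

lemma ι_extFam (o : ℕ → Bool) {A D : ChainComplex C ℕ} (P : ProjectiveResolution M)
    (Q : ProjectiveResolution N) (n : ℤ) (φ : Fam A P.complex) (ψ : Fam D Q.complex)
    (s k i j : ℕ) (h : i + j = s) :
    HomologicalComplex.ιTensorObj A D i j s h ≫ extFam o P Q n φ ψ s k =
      extTerm o P Q n φ ψ k i j :=
  ι_tensorDesc _ _ _ _ _

lemma pCount_add_dCount (o : ℕ → Bool) (k : ℕ) : pCount o k + dCount o k = k := by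
  induction k with
  | zero => rfl
  | succ k ih =>
    rw [pCount, dCount]
    cases o k <;> simp only [pStep, dStep] <;> lia

lemma extFam_mem_cochains (o : ℕ → Bool) {A D : ChainComplex C ℕ} (P : ProjectiveResolution M)
    (Q : ProjectiveResolution N) {m n l : ℤ} (hl : m + n = l) {φ : Fam A P.complex}
    {ψ : Fam D Q.complex} (hφ : φ ∈ cochains A P.complex m) (hψ : ψ ∈ cochains D Q.complex n) :
    extFam o P Q n φ ψ ∈ cochains (tensorComplex A D) (pathComplex o P Q) l := by
  intro s k hs
  refine tensor_hom_ext fun i j h => ?_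
  rw [ι_extFam, comp_zero, extTerm]
  have := pCount_add_dCount o k
  by_cases hi : (i : ℤ) = pCount o k + m
  · rw [hψ j _ (by lia), MonoidalPreadditive.tensor_zero, zero_comp, smul_zero]; rfl
  · rw [hφ i _ hi, MonoidalPreadditive.zero_tensor, zero_comp, smul_zero]; rfl

lemma stepQuot_π (P : ProjectiveResolution M) (Q : ProjectiveResolution N) (b : Bool)
    (p d : ℕ) : stepQuot P Q b p d ≫ stepπ P Q b p d = syzygyπ P p ⊗ₘ syzygyπ Q d := by
  cases b
  · exact (MonoidalCategory.tensorHom_def _ _).symm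
  · exact (MonoidalCategory.tensorHom_def' _ _).symm

lemma step_comp (P : ProjectiveResolution M) (Q : ProjectiveResolution N) (b : Bool)
    (p d : ℕ) {U V : C} (x : ∀ p, U ⟶ P.complex.X p) (y : ∀ d, V ⟶ Q.complex.X d) :
    ((x (pStep b p) ≫ syzygyπ P (pStep b p)) ⊗ₘ (y (dStep b d) ≫ syzygyπ Q (dStep b d))) ≫
        stepι P Q b p d =
      ((x (p + 1) ≫ P.complex.d (p + 1) p) ⊗ₘ y d) ≫ stepQuot P Q b p d +
        (p : ℤ).negOnePow • ((x p ⊗ₘ (y (d + 1) ≫ Q.complex.d (d + 1) d)) ≫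
          stepQuot P Q b p d) := by
  cases b
  · change ((x p ≫ syzygyπ P p) ⊗ₘ (y (d + 1) ≫ syzygyπ Q (d + 1))) ≫
        ((p : ℤ).negOnePow • (syzygy P p ◁ syzygyι Q d)) =
      ((x (p + 1) ≫ P.complex.d (p + 1) p) ⊗ₘ y d) ≫ syzygyπ P p ▷ Q.complex.X d +
        (p : ℤ).negOnePow • ((x p ⊗ₘ (y (d + 1) ≫ Q.complex.d (d + 1) d)) ≫
          syzygyπ P p ▷ Q.complex.X d)
    rw [← MonoidalCategory.tensorHom_id, ← MonoidalCategory.id_tensorHom,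
      MonoidalCategory.tensorHom_comp_tensorHom, MonoidalCategory.tensorHom_comp_tensorHom,
      Linear.comp_units_smul, MonoidalCategory.tensorHom_comp_tensorHom]
    simp only [Category.assoc, d_syzygyπ, syzygyπ_ι, comp_zero, MonoidalPreadditive.zero_tensor,
      zero_add, Category.comp_id]
  · change ((x (p + 1) ≫ syzygyπ P (p + 1)) ⊗ₘ (y d ≫ syzygyπ Q d)) ≫
        (syzygyι P p ▷ syzygy Q d) =
      ((x (p + 1) ≫ P.complex.d (p + 1) p) ⊗ₘ y d) ≫ P.complex.X p ◁ syzygyπ Q d +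
        (p : ℤ).negOnePow • ((x p ⊗ₘ (y (d + 1) ≫ Q.complex.d (d + 1) d)) ≫
          P.complex.X p ◁ syzygyπ Q d)
    rw [← MonoidalCategory.tensorHom_id, ← MonoidalCategory.id_tensorHom,
      MonoidalCategory.tensorHom_comp_tensorHom, MonoidalCategory.tensorHom_comp_tensorHom,
      MonoidalCategory.tensorHom_comp_tensorHom]
    simp only [Category.assoc, d_syzygyπ, syzygyπ_ι, comp_zero, MonoidalPreadditive.tensor_zero,
      add_zero, smul_zero, Category.comp_id]

lemma path_comp (o : ℕ → Bool) (P : ProjectiveResolution M) (Q : ProjectiveResolution N)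
    (k : ℕ) {U V : C} (x : ∀ p, U ⟶ P.complex.X p) (y : ∀ d, V ⟶ Q.complex.X d) :
    ((x (pCount o (k + 1)) ⊗ₘ y (dCount o (k + 1))) ≫ pathQuot o P Q (k + 1)) ≫
        (pathπ o P Q (k + 1) ≫ pathι o P Q k) =
      ((x (pCount o k + 1) ≫ P.complex.d (pCount o k + 1) (pCount o k)) ⊗ₘ y (dCount o k)) ≫
          pathQuot o P Q k +
        (pCount o k : ℤ).negOnePow • ((x (pCount o k) ⊗ₘ
          (y (dCount o k + 1) ≫ Q.complex.d (dCount o k + 1) (dCount o k))) ≫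
            pathQuot o P Q k) := by
  refine Eq.trans ?_ (step_comp P Q (o k) (pCount o k) (dCount o k) x y)
  rw [Category.assoc]
  have h : pathQuot o P Q (k + 1) ≫ pathπ o P Q (k + 1) =
      (syzygyπ P (pCount o (k + 1)) ⊗ₘ syzygyπ Q (dCount o (k + 1))) :=
    stepQuot_π P Q _ _ _
  rw [reassoc_of% h, MonoidalCategory.tensorHom_comp_tensorHom_assoc]
  rfl

lemma extTerm_diff (o : ℕ → Bool) {A D : ChainComplex C ℕ} (P : ProjectiveResolution M)
    (Q : ProjectiveResolution N) {m n : ℤ} {φ : Fam A P.complex}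
    (hφ : φ ∈ cochains A P.complex m) (ψ : Fam D Q.complex) (k i j : ℕ) :
    extTerm o P Q n φ ψ (k + 1) i j ≫ (pathπ o P Q (k + 1) ≫ pathι o P Q k) -
        (m + n).negOnePow • ((A.d i (i - 1) ▷ D.X j) ≫ extTerm o P Q n φ ψ k (i - 1) j +
          (i : ℤ).negOnePow • ((A.X i ◁ D.d j (j - 1)) ≫ extTerm o P Q n φ ψ k i (j - 1))) =
      extTerm o P Q n (diff A P.complex m φ) ψ k i j +
        m.negOnePow • extTerm o P Q (n + 1) φ (diff D Q.complex n ψ) k i j := by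
  unfold extTerm
  rw [Linear.units_smul_comp, path_comp o P Q k (φ i) (ψ j)]
  generalize pathQuot o P Q k = q
  generalize dCount o k = d at *
  generalize pCount o k = p at *
  generalize pathX o P Q k = W at q
  have hb : ((i : ℤ) * n).negOnePow • (p : ℤ).negOnePow •
        (φ i p ⊗ₘ (ψ j (d + 1) ≫ Q.complex.d (d + 1) d)) ≫ q =
      m.negOnePow • ((i : ℤ) * (n + 1)).negOnePow •
        (φ i p ⊗ₘ (ψ j (d + 1) ≫ Q.complex.d (d + 1) d)) ≫ q := by
    by_cases h : (i : ℤ) = p + m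
    · simp only [smul_smul, ← Int.negOnePow_add]
      congr 1
      rw [Int.negOnePow_eq_iff, h]
      exact ⟨-m, by ring⟩
    · rw [hφ i p h, MonoidalPreadditive.zero_tensor, zero_comp, smul_zero, smul_zero, smul_zero,
        smul_zero]
  have ha : ((i : ℤ) * n).negOnePow • m.negOnePow • ((A.d i (i - 1) ≫ φ (i - 1) p) ⊗ₘ ψ j d) ≫ q =
      (m + n).negOnePow • (((i - 1 : ℕ) : ℤ) * n).negOnePow •
        ((A.d i (i - 1) ≫ φ (i - 1) p) ⊗ₘ ψ j d) ≫ q := by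
    rcases i with _ | i
    · rw [d_zero_zero, zero_comp, MonoidalPreadditive.zero_tensor, zero_comp]
      simp only [smul_zero]
    · simp only [smul_smul, ← Int.negOnePow_add]
      congr 1
      rw [Int.negOnePow_eq_iff, Nat.add_sub_cancel]
      exact ⟨0, by push_cast; ring⟩
  have hc : m.negOnePow • ((i : ℤ) * (n + 1)).negOnePow • n.negOnePow •
        (φ i p ⊗ₘ (D.d j (j - 1) ≫ ψ (j - 1) d)) ≫ q =
      (m + n).negOnePow • (i : ℤ).negOnePow • ((i : ℤ) * n).negOnePow •
        (φ i p ⊗ₘ (D.d j (j - 1) ≫ ψ (j - 1) d)) ≫ q := by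
    simp only [smul_smul, ← Int.negOnePow_add]
    congr 1
    rw [Int.negOnePow_eq_iff]
    exact ⟨0, by ring⟩
  have wa : A.d i (i - 1) ▷ D.X j ≫ (φ (i - 1) p ⊗ₘ ψ j d) ≫ q =
      ((A.d i (i - 1) ≫ φ (i - 1) p) ⊗ₘ ψ j d) ≫ q := by
    rw [← MonoidalCategory.tensorHom_id, MonoidalCategory.tensorHom_comp_tensorHom_assoc,
      Category.id_comp]
  have wc : A.X i ◁ D.d j (j - 1) ≫ (φ i p ⊗ₘ ψ (j - 1) d) ≫ q =
      (φ i p ⊗ₘ (D.d j (j - 1) ≫ ψ (j - 1) d)) ≫ q := by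
    rw [← MonoidalCategory.id_tensorHom, MonoidalCategory.tensorHom_comp_tensorHom_assoc,
      Category.id_comp]
  have sl : ∀ {X₁ Y₁ X₂ Y₂ : C} (f f' : X₁ ⟶ Y₁) (g : X₂ ⟶ Y₂) (e : ℤˣ),
      ((f - e • f') ⊗ₘ g) = (f ⊗ₘ g) - e • (f' ⊗ₘ g) := by
    intro X₁ Y₁ X₂ Y₂ f f' g e
    have hn : ((-f') ⊗ₘ g) = -(f' ⊗ₘ g) := by
      rw [eq_neg_iff_add_eq_zero, ← MonoidalPreadditive.add_tensor, neg_add_cancel,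
        MonoidalPreadditive.zero_tensor]
    rcases Int.units_eq_one_or e with h | h <;> subst h <;>
      simp [sub_eq_add_neg, MonoidalPreadditive.add_tensor, Units.neg_smul, hn]
  have sr : ∀ {X₁ Y₁ X₂ Y₂ : C} (f f' : X₁ ⟶ Y₁) (g : X₂ ⟶ Y₂) (e : ℤˣ),
      (g ⊗ₘ (f - e • f')) = (g ⊗ₘ f) - e • (g ⊗ₘ f') := by
    intro X₁ Y₁ X₂ Y₂ f f' g e
    have hn : (g ⊗ₘ (-f')) = -(g ⊗ₘ f') := by
      rw [eq_neg_iff_add_eq_zero, ← MonoidalPreadditive.tensor_add, neg_add_cancel,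
        MonoidalPreadditive.tensor_zero]
    rcases Int.units_eq_one_or e with h | h <;> subst h <;>
      simp [sub_eq_add_neg, MonoidalPreadditive.tensor_add, Units.neg_smul, hn]
  simp only [diff_apply, sl, sr, Preadditive.sub_comp, smul_sub, smul_add, Linear.units_smul_comp,
    Linear.comp_units_smul, wa, wc, ha, hc, hb]
  abel

lemma diff_extFam (o : ℕ → Bool) {A D : ChainComplex C ℕ} (P : ProjectiveResolution M)
    (Q : ProjectiveResolution N) {m n l : ℤ} (hl : m + n = l) {φ : Fam A P.complex}
    (hφ : φ ∈ cochains A P.complex m) (ψ : Fam D Q.complex) :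
    diff (tensorComplex A D) (pathComplex o P Q) l (extFam o P Q n φ ψ) =
      extFam o P Q n (diff A P.complex m φ) ψ +
        m.negOnePow • extFam o P Q (n + 1) φ (diff D Q.complex n ψ) := by
  subst hl
  refine funext fun s => funext fun k => ?_
  have h0 : diff (tensorComplex A D) (pathComplex o P Q) (m + n) (extFam o P Q n φ ψ) s k =
      tensorDesc (extTerm o P Q n φ ψ (k + 1)) s ≫ (pathπ o P Q (k + 1) ≫ pathι o P Q k) -
        (m + n).negOnePow • ((tensorComplex A D).d s (s - 1) ≫
          tensorDesc (extTerm o P Q n φ ψ k) (s - 1)) :=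
    congrArg (fun t : pathX o P Q (k + 1) ⟶ pathX o P Q k =>
        tensorDesc (extTerm o P Q n φ ψ (k + 1)) s ≫ t -
        (m + n).negOnePow • ((tensorComplex A D).d s (s - 1) ≫
          tensorDesc (extTerm o P Q n φ ψ k) (s - 1))) (pathComplex_d o P Q k)
  have h1 : tensorDesc (extTerm o P Q n φ ψ (k + 1)) s ≫ (pathπ o P Q (k + 1) ≫ pathι o P Q k) -
        (m + n).negOnePow • ((tensorComplex A D).d s (s - 1) ≫
          tensorDesc (extTerm o P Q n φ ψ k) (s - 1)) =
      tensorDesc (extTerm o P Q n (diff A P.complex m φ) ψ k) s +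
        m.negOnePow • tensorDesc (extTerm o P Q (n + 1) φ (diff D Q.complex n ψ) k) s := by
    refine tensor_hom_ext fun i j h => ?_
    rw [d_tensorDesc, Preadditive.comp_sub, Preadditive.comp_add, Linear.comp_units_smul,
      Linear.comp_units_smul, ι_tensorDesc, ← Category.assoc, ι_tensorDesc, ι_tensorDesc,
      ι_tensorDesc]
    exact extTerm_diff o P Q hφ ψ k i j
  exact h0.trans h1

lemma pCount_mono_le (o : ℕ → Bool) {k l : ℕ} (h : k ≤ l) : pCount o k ≤ pCount o l := by
  induction l, h using Nat.le_induction with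
  | base => exact le_rfl
  | succ l _ ih =>
    refine ih.trans ?_
    rw [pCount]
    cases o l <;> simp [pStep]

lemma dCount_mono_le (o : ℕ → Bool) {k l : ℕ} (h : k ≤ l) : dCount o k ≤ dCount o l := by
  induction l, h using Nat.le_induction with
  | base => exact le_rfl
  | succ l _ ih =>
    refine ih.trans ?_
    rw [dCount]
    cases o l <;> simp [dStep]

/-- Both kinds of steps occur infinitely often. -/
structure IsPath (o : ℕ → Bool) : Prop where
  exists_true : ∀ N, ∃ k, N ≤ k ∧ o k = true
  exists_false : ∀ N, ∃ k, N ≤ k ∧ o k = false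

lemma IsPath.le_pCount {o : ℕ → Bool} (ho : IsPath o) (N : ℕ) :
    ∃ K, ∀ k, K ≤ k → N ≤ pCount o k := by
  induction N with
  | zero => exact ⟨0, fun _ _ => Nat.zero_le _⟩
  | succ N ih =>
    obtain ⟨K, hK⟩ := ih
    obtain ⟨l, hl, e⟩ := ho.exists_true K
    refine ⟨l + 1, fun k hk => le_trans ?_ (pCount_mono_le o hk)⟩
    rw [pCount, e]
    exact Nat.succ_le_succ (hK l hl)

lemma IsPath.le_dCount {o : ℕ → Bool} (ho : IsPath o) (N : ℕ) :
    ∃ K, ∀ k, K ≤ k → N ≤ dCount o k := by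
  induction N with
  | zero => exact ⟨0, fun _ _ => Nat.zero_le _⟩
  | succ N ih =>
    obtain ⟨K, hK⟩ := ih
    obtain ⟨l, hl, e⟩ := ho.exists_false K
    refine ⟨l + 1, fun k hk => le_trans ?_ (dCount_mono_le o hk)⟩
    rw [dCount, e]
    exact Nat.succ_le_succ (hK l hl)

section Ext

variable {o : ℕ → Bool} {A D : ChainComplex C ℕ} (P : ProjectiveResolution M)
  (Q : ProjectiveResolution N)

lemma extFam_mem_bounded_left (ho : IsPath o) (n : ℤ) {φ : Fam A P.complex}
    (hφ : φ ∈ bounded A P.complex) (ψ : Fam D Q.complex) :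
    extFam o P Q n φ ψ ∈ bounded (tensorComplex A D) (pathComplex o P Q) := by
  obtain ⟨K, hK⟩ := hφ
  obtain ⟨L, hL⟩ := ho.le_pCount K
  refine ⟨L, fun s k hk => tensor_hom_ext fun i j h => ?_⟩
  rw [ι_extFam, comp_zero, extTerm, hK _ _ (hL k hk), MonoidalPreadditive.zero_tensor, zero_comp,
    smul_zero]
  rfl

lemma extFam_mem_bounded_right (ho : IsPath o) (n : ℤ) (φ : Fam A P.complex)
    {ψ : Fam D Q.complex} (hψ : ψ ∈ bounded D Q.complex) :
    extFam o P Q n φ ψ ∈ bounded (tensorComplex A D) (pathComplex o P Q) := by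
  obtain ⟨K, hK⟩ := hψ
  obtain ⟨L, hL⟩ := ho.le_dCount K
  refine ⟨L, fun s k hk => tensor_hom_ext fun i j h => ?_⟩
  rw [ι_extFam, comp_zero, extTerm, hK _ _ (hL k hk), MonoidalPreadditive.tensor_zero, zero_comp,
    smul_zero]
  rfl

lemma units_smul_mem {X : Type*} [AddCommGroup X] (S : AddSubgroup X) (e : ℤˣ) {x : X}
    (hx : x ∈ S) : e • x ∈ S := by
  rcases Int.units_eq_one_or e with h | h <;> subst h
  · rwa [one_smul]
  · rw [Units.neg_smul, one_smul]; exact neg_mem hx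

lemma extFam_mem_almostCocycles (ho : IsPath o) {m n l : ℤ} (hl : m + n = l)
    {φ : Fam A P.complex} {ψ : Fam D Q.complex} (hφ : φ ∈ almostCocycles A P.complex m)
    (hψ : ψ ∈ almostCocycles D Q.complex n) :
    extFam o P Q n φ ψ ∈ almostCocycles (tensorComplex A D) (pathComplex o P Q) l := by
  refine ⟨extFam_mem_cochains o P Q hl hφ.1 hψ.1, ?_⟩
  change diff _ _ l _ ∈ bounded _ _
  rw [diff_extFam o P Q hl hφ.1]
  exact add_mem (extFam_mem_bounded_left P Q ho n hφ.2 ψ)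
    (units_smul_mem _ _ (extFam_mem_bounded_right P Q ho (n + 1) φ hψ.2))

lemma extFam_mem_almostCoboundaries_left (ho : IsPath o) {m n l : ℤ} (hl : m + n = l)
    {φ : Fam A P.complex} {ψ : Fam D Q.complex} (hφ : φ ∈ almostCoboundaries A P.complex m)
    (hψ : ψ ∈ almostCocycles D Q.complex n) :
    extFam o P Q n φ ψ ∈ almostCoboundaries (tensorComplex A D) (pathComplex o P Q) l := by
  refine ⟨extFam_mem_cochains o P Q hl hφ.1 hψ.1, ?_⟩
  obtain ⟨_, ⟨χ, hχ, rfl⟩, β, hβ, rfl⟩ := AddSubgroup.mem_sup.1 hφ.2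
  rw [map_add, AddMonoidHom.add_apply]
  refine add_mem ?_ (AddSubgroup.mem_sup_right (extFam_mem_bounded_left P Q ho n hβ ψ))
  have e := diff_extFam o P Q (m := m - 1) (n := n) (l := l - 1) (by lia) hχ ψ
  have hc : extFam o P Q n χ ψ ∈ cochains (tensorComplex A D) (pathComplex o P Q) (l - 1) :=
    extFam_mem_cochains o P Q (by lia) hχ hψ.1
  rw [← sub_eq_iff_eq_add.2 e]
  exact AddSubgroup.sub_mem _ (AddSubgroup.mem_sup_left ⟨_, hc, rfl⟩)
    (AddSubgroup.mem_sup_right (units_smul_mem _ _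
      (extFam_mem_bounded_right P Q ho (n + 1) χ hψ.2)))

lemma extFam_mem_almostCoboundaries_right (ho : IsPath o) {m n l : ℤ} (hl : m + n = l)
    {φ : Fam A P.complex} {ψ : Fam D Q.complex} (hφ : φ ∈ almostCocycles A P.complex m)
    (hψ : ψ ∈ almostCoboundaries D Q.complex n) :
    extFam o P Q n φ ψ ∈ almostCoboundaries (tensorComplex A D) (pathComplex o P Q) l := by
  refine ⟨extFam_mem_cochains o P Q hl hφ.1 hψ.1, ?_⟩
  obtain ⟨_, ⟨χ, hχ, rfl⟩, β, hβ, rfl⟩ := AddSubgroup.mem_sup.1 hψ.2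
  rw [map_add]
  refine add_mem ?_ (AddSubgroup.mem_sup_right (extFam_mem_bounded_right P Q ho n φ hβ))
  -- the sign of the product depends on the degree of the second factor
  have e := diff_extFam o P Q (m := m) (n := n - 1) (l := l - 1) (by lia) hφ.1 χ
  rw [sub_add_cancel] at e
  have hc : extFam o P Q (n - 1) φ χ ∈ cochains (tensorComplex A D) (pathComplex o P Q) (l - 1) :=
    extFam_mem_cochains o P Q (by lia) hφ.1 hχ
  have h1 : m.negOnePow • extFam o P Q n φ (diff D Q.complex (n - 1) χ) ∈
      (cochains (tensorComplex A D) (pathComplex o P Q) (l - 1)).map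
        (diff (tensorComplex A D) (pathComplex o P Q) (l - 1)) ⊔
      bounded (tensorComplex A D) (pathComplex o P Q) := by
    rw [← sub_eq_iff_eq_add'.2 e]
    exact AddSubgroup.sub_mem _ (AddSubgroup.mem_sup_left ⟨_, hc, rfl⟩)
      (AddSubgroup.mem_sup_right (extFam_mem_bounded_left P Q ho (n - 1) hφ.2 χ))
  have h2 := units_smul_mem _ m.negOnePow h1
  rwa [smul_smul, Int.units_mul_self, one_smul] at h2

/-- The external product of completed Ext groups: the class of `φ ⊗ᵒ ψ`. -/
noncomputable def extProd (ho : IsPath o) {m n l : ℤ} (hl : m + n = l) :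
    CExt m A P.complex →+ CExt n D Q.complex →+
      CExt l (tensorComplex A D) (pathComplex o P Q) :=
  quotientMap₂ (extFam o P Q n)
    (fun _ hφ _ hψ => extFam_mem_almostCocycles P Q ho hl hφ hψ)
    (fun _ _ hφ _ hψ => extFam_mem_almostCoboundaries_left P Q ho hl hφ hψ)
    (fun _ hφ _ _ hψ => extFam_mem_almostCoboundaries_right P Q ho hl hφ hψ)

end Ext

/-- The augmentation of a resolution `P` of `M`, as a family of morphisms `P_i ⟶ M`. -/
noncomputable def augTo (P : ProjectiveResolution M) : ∀ i : ℕ, P.complex.X i ⟶ M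
  | 0 => P.π.f 0
  | _ + 1 => 0

/-- The augmentation of `P ⊗ Q` with values in `M ⊗ N`. -/
noncomputable def tensorAug (P : ProjectiveResolution M) (Q : ProjectiveResolution N) :
    (tensorComplex P.complex Q.complex).X 0 ⟶ M ⊗ N :=
  tensorDesc (fun i j => augTo P i ⊗ₘ augTo Q j) 0

/-- The augmentation of `P ⊗ᵒ Q` with values in `M ⊗ N`: the projection of `P₀ ⊗ N` or `M ⊗ Q₀`. -/
noncomputable def pathAug (o : ℕ → Bool) (P : ProjectiveResolution M)
    (Q : ProjectiveResolution N) : (pathComplex o P Q).X 0 ⟶ M ⊗ N :=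
  pathπ o P Q 0

/-- `Δ` is a chain map lifting `f : L ⟶ M ⊗ N` to the resolutions `T` and `P ⊗ Q`. -/
def IsTensorLift {L : C} (T : ProjectiveResolution L) (P : ProjectiveResolution M)
    (Q : ProjectiveResolution N) (f : L ⟶ M ⊗ N)
    (Δ : T.complex ⟶ tensorComplex P.complex Q.complex) : Prop :=
  Δ.f 0 ≫ tensorAug P Q = augTo T 0 ≫ f

/-- `θ` is a chain map lifting `g : M ⊗ N ⟶ L` to the resolutions `P ⊗ᵒ Q` and `T`. -/
def IsPathLift (o : ℕ → Bool) (P : ProjectiveResolution M) (Q : ProjectiveResolution N) {L : C}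
    (T : ProjectiveResolution L) (g : M ⊗ N ⟶ L) (θ : pathComplex o P Q ⟶ T.complex) : Prop :=
  θ.f 0 ≫ augTo T 0 = pathAug o P Q ≫ g

/-- The cup product: the external product with values in the completed Ext of `A ⊗ A` and
`P ⊗ᵒ Q`, pulled back along `Δ : A ⟶ A ⊗ A` and pushed forward along `θ : P ⊗ᵒ Q ⟶ T`. -/
noncomputable def cup {o : ℕ → Bool} (ho : IsPath o) {A : ChainComplex C ℕ}
    (P : ProjectiveResolution M) (Q : ProjectiveResolution N) {T : ChainComplex C ℕ}
    (Δ : A ⟶ tensorComplex A A) (θ : pathComplex o P Q ⟶ T) {m n l : ℤ} (hl : m + n = l) :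
    CExt m A P.complex →+ CExt n A Q.complex →+ CExt l A T :=
  (extProd P Q ho hl).compr₂ ((yoneda (zero_add l) (ofHom θ)).comp
    ((yoneda (add_zero l)).flip (ofHom Δ)))

/-- For every syzygy `F` of the resolution, `F ⊗ -` and `- ⊗ F` are exact and preserve
projectives. -/
structure FlatSyzygies (P : ProjectiveResolution M) : Prop where
  tensorLeft_preservesFiniteLimits : ∀ k, PreservesFiniteLimits (tensorLeft (syzygy P k))
  tensorLeft_preservesFiniteColimits : ∀ k, PreservesFiniteColimits (tensorLeft (syzygy P k))
  tensorRight_preservesFiniteLimits : ∀ k, PreservesFiniteLimits (tensorRight (syzygy P k))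
  tensorRight_preservesFiniteColimits : ∀ k, PreservesFiniteColimits (tensorRight (syzygy P k))
  tensorLeft_preservesProjectives :
    ∀ k, (tensorLeft (syzygy P k)).PreservesProjectiveObjects
  tensorRight_preservesProjectives :
    ∀ k, (tensorRight (syzygy P k)).PreservesProjectiveObjects

end Tensor
section Objects

open scoped MonObj AddMonObj

variable {𝓔 : Type u} [Category.{v} 𝓔] [CartesianMonoidalCategory 𝓔] [BraidedCategory 𝓔]

/-- `R`-module objects: abelian group objects with an action of the ring object `R` which is
biadditive (expressed on generalized elements) besides being unital and associative. -/
structure RMod (R : 𝓔) [RingObj R] where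
  X : 𝓔
  [addGrp : AddGrpObj X]
  [comm : IsCommAddMonObj X]
  [mod : ModObj R X]
  smul_add : ∀ {T : 𝓔} (r : T ⟶ R) (x y : T ⟶ X), r • (x + y) = r • x + r • y
  add_smul : ∀ {T : 𝓔} (r s : T ⟶ R) (x : T ⟶ X), (r + s) • x = r • x + s • x

attribute [instance] RMod.addGrp RMod.comm RMod.mod

variable {R : 𝓔} [RingObj R]

/-- Morphisms of `R`-module objects: additive and `R`-linear morphisms. -/
@[ext]
structure RMod.Hom (X Y : RMod R) where
  hom : X.X ⟶ Y.X
  [isAddMonHom : IsAddMonHom hom]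
  [isModHom : IsModHom R hom]

attribute [instance] RMod.Hom.isAddMonHom RMod.Hom.isModHom

instance : Category (RMod R) where
  Hom X Y := RMod.Hom X Y
  id X := { hom := 𝟙 X.X }
  comp f g := { hom := f.hom ≫ g.hom }

variable (R) in
/-- The ring object `R` as a (left) module object over itself. -/
def RMod.regular : RMod R :=
  letI : ModObj R R := ModObj.regular R
  { X := R
    smul_add := fun r x y => CategoryTheory.Hom.mul_add r x y
    add_smul := fun r s x => CategoryTheory.Hom.add_mul r s x }

/-- `R`-module objects with a compatible action of the group object `G`, that is an action by
additive and `R`-linear maps. -/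
structure GRMod (R : 𝓔) [RingObj R] (G : 𝓔) [GrpObj G] where
  toRMod : RMod R
  [act : ModObj G toRMod.X]
  act_add : ∀ {T : 𝓔} (g : T ⟶ G) (x y : T ⟶ toRMod.X), g • (x + y) = g • x + g • y
  act_smul : ∀ {T : 𝓔} (g : T ⟶ G) (r : T ⟶ R) (x : T ⟶ toRMod.X), g • r • x = r • g • x

attribute [instance] GRMod.act

variable {G : 𝓔} [GrpObj G]

/-- Morphisms of `R`-module objects that are equivariant for `G`. -/
@[ext]
structure GRMod.Hom (X Y : GRMod R G) where
  hom : X.toRMod ⟶ Y.toRMod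
  [isModHom : IsModHom G hom.hom]

attribute [instance] GRMod.Hom.isModHom

instance : Category (GRMod R G) where
  Hom X Y := GRMod.Hom X Y
  id X :=
    { hom := 𝟙 X.toRMod
      isModHom := inferInstanceAs (IsModHom G (𝟙 X.toRMod.X)) }
  comp f g :=
    { hom := f.hom ≫ g.hom
      isModHom := inferInstanceAs (IsModHom G (f.hom.hom ≫ g.hom.hom)) }

variable (G) in
/-- An `R`-module object with the trivial action of `G`. -/
def GRMod.ofTrivialAction (X : RMod R) : GRMod R G :=
  letI : ModObj G X.X := ModObj.trivialAction G X.X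
  have h : ∀ {T : 𝓔} (g : T ⟶ G) (x : T ⟶ X.X), g • x = x :=
    fun _ _ => CartesianMonoidalCategory.lift_snd _ _
  { toRMod := X
    act := ModObj.trivialAction G X.X
    act_add := fun g x y => (h g (x + y)).trans
      (congrArg₂ (fun a b : _ ⟶ X.X => a + b) (h g x).symm (h g y).symm)
    act_smul := fun g r x => (h g (r • x)).trans
      (congrArg (fun a : _ ⟶ X.X => r • a) (h g x).symm) }

variable (R G) in
/-- The ring object `R` as an `R`-module object with trivial action of `G`. -/
def GRMod.trivial : GRMod R G :=
  GRMod.ofTrivialAction G (RMod.regular R)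

variable (R G) in
/-- The restriction functor forgetting the action of `G`. -/
def GRMod.restrict : GRMod R G ⥤ RMod R where
  obj X := X.toRMod
  map f := f.hom

end Objects

section Ring

open scoped DirectSum

/-- `⨁ Xⁿ`, with its usual addition, is a graded ring whose multiplication is given on homogeneous
elements by the biadditive maps `mul` and whose identity is `one`. -/
def IsGradedRing {X : ℤ → Type v} [∀ n, AddCommGroup (X n)] (one : X 0)
    (mul : ∀ i j : ℤ, X i →+ X j →+ X (i + j)) : Prop :=
  ∃ r : Ring (⨁ n : ℤ, X n),
    r.toAddCommGroup = (inferInstance : AddCommGroup (⨁ n : ℤ, X n)) ∧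
    1 = DirectSum.of X 0 one ∧
    ∀ (i j : ℤ) (x : X i) (y : X j),
      DirectSum.of X i x * DirectSum.of X j y = DirectSum.of X (i + j) (mul i j x y)

end Ring

end CompletedExt

open CompletedExt

/-!
The Yoneda part is formal: families of morphisms compose associatively and the family of an identity
is neutral, so that `isGradedRing_of_assoc` applies. The cup product part comes down to comparing cup
products with compositions.

Since `R` is projective after restriction to `R`-modules, the sequences of which the resolution `P`
of `R` is spliced become split there. Restriction is exact, faithful and monoidal, so these sequences
remain exact after tensoring with any object, on either side (`tensorExact_of_restrict`). Hence
`X ⊗ P` and `P ⊗ X` have exact augmented rows, resp. columns, for every complex `X`, and equations for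
families of morphisms `T_p ⟶ X_i ⊗ P_j` on a complex of projectives `T` can be solved one column
after the other, even if they hold for `i ≥ N` only (`exists_dblDiff_eq`). This yields the diagonals
`Δ` and, for every complex of projectives `X`, coactions `δ : X ⟶ X ⊗ P` and `X ⟶ P ⊗ X` that are
strictly counital.

For an almost chain map `φ : P ⟶ Q` the families `(φ ⊗ id) ∘ Δ` and `δ ∘ φ` have the same augmentation
up to homotopy, and their difference `u` is a cocycle on the rows `i ≥ N`, where `φ` commutes with
the differentials. So `u` is a coboundary up to a family with values in `Q_{<N} ⊗ P`
(`TensorExact.exists_actLeft_sub_preComp`, `TensorExact.exists_actRight_sub_preComp`). Both indices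
tend to infinity along the sequence of steps defining `Q ⊗ᵒ P`, so the projection
`τ : Q ⊗ P ⟶ Q ⊗ᵒ P` turns the latter family into a bounded one. Therefore
`θ ∘ (φ ⊗ᵒ id) ∘ Δ` and `(θ ∘ τ ∘ δ) ∘ φ` have the same class, and `θ ∘ τ ∘ δ` is homotopic to the
identity because it lifts the identity. This is the right unit law; the left one is symmetric.

Finally `φ ⊗ᵒ ψ = (φ ⊗ᵒ id) ∘ (id ⊗ ψ)`, and replacing `(id ⊗ ψ) ∘ Δ` by `δ ∘ ψ` in the same manner
shows that the cup product of `x` with a class `y` having coefficients in `R` is the Yoneda product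
`x ∘ y` (`cup_eq_yoneda`). So the cup product ring of `R` is associative, being the Yoneda ring.
-/

namespace CompletedExt

/-! ### Syzygy sequences and comparison of resolutions -/

section SyzygySequence

variable {C : Type u} [Category.{v} C] [Abelian C] {M : C}

/-- The short exact sequence `0 ⟶ P̃_{k+1} ⟶ P_k ⟶ P̃_k ⟶ 0`. -/
@[simps]
noncomputable def syzygySeq (P : ProjectiveResolution M) (k : ℕ) : ShortComplex C :=
  ShortComplex.mk (syzygyι P k) (syzygyπ P k) (syzygyι_π P k)

instance mono_syzygyι (P : ProjectiveResolution M) (k : ℕ) : Mono (syzygyι P k) :=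
  inferInstanceAs (Mono (kernel.ι (augD P k)))

lemma exact_augD (P : ProjectiveResolution M) (k : ℕ) :
    (ShortComplex.mk (P.complex.d (k + 1) k) (augD P k) (d_augD P k)).Exact := by
  rcases k with _ | k
  · exact P.exact₀
  · exact P.exact_succ k

instance epi_syzygyπ (P : ProjectiveResolution M) (k : ℕ) : Epi (syzygyπ P k) := by
  rcases k with _ | k
  · exact inferInstanceAs (Epi (P.π.f 0))
  · exact (exact_augD P k).epi_kernelLift

lemma syzygySeq_exact (P : ProjectiveResolution M) (k : ℕ) : (syzygySeq P k).Exact := by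
  rcases k with _ | k
  · exact ShortComplex.exact_of_f_is_kernel _ (kernelIsKernel (augD P 0))
  · refine ShortComplex.exact_of_f_is_kernel _ ?_
    -- the kernel of `P_{k+1} ⟶ P_k` is that of its epimorphic part
    refine isKernelOfComp (syzygyι P k) (augD P (k + 1)) (kernelIsKernel (augD P (k + 1)))
      (syzygyι_π P (k + 1)) (syzygyπ_ι P k)

lemma syzygySeq_shortExact (P : ProjectiveResolution M) (k : ℕ) : (syzygySeq P k).ShortExact where
  exact := syzygySeq_exact P k
  mono_f := mono_syzygyι P k
  epi_g := epi_syzygyπ P k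

end SyzygySequence

section Comparison

variable {C : Type u} [Category.{v} C]

/-- The difference of the families of two homotopic chain maps is a coboundary. -/
lemma exists_diff_eq_of_homotopy [Preadditive C] {A B : ChainComplex C ℕ} {f g : A ⟶ B}
    (H : Homotopy f g) :
    ∃ κ ∈ cochains A B (-1), diff A B (-1) κ = homFam f - homFam g := by
  refine ⟨fun p q => H.hom p q, fun p q h => H.zero p q ?_, ?_⟩
  · simp only [ComplexShape.down_Rel]; lia
  funext p q
  change _ = homFam f p q - homFam g p q
  rw [diff_apply]
  have hs : (-1 : ℤ).negOnePow = -1 := by simp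
  rw [hs, Units.neg_smul, one_smul, sub_neg_eq_add]
  by_cases h : p = q
  · subst h
    rw [homFam_self, homFam_self, H.comm p, add_sub_cancel_right, add_comm,
      prevD_eq H.hom (show (ComplexShape.down ℕ).Rel (p + 1) p from rfl)]
    congr 1
    rcases p with _ | p
    · rw [d_zero_zero, zero_comp, dNext_eq_zero]
      simp
    · rw [dNext_eq H.hom (show (ComplexShape.down ℕ).Rel (p + 1) p from rfl)]
      rfl
  · rw [homFam_of_ne f h, homFam_of_ne g h, sub_zero, H.zero p (q + 1), zero_comp, zero_add]
    · rcases p with _ | p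
      · rw [d_zero_zero, zero_comp]
      · rw [Nat.add_sub_cancel, H.zero p q, comp_zero]
        simp only [ComplexShape.down_Rel]; lia
    · simp only [ComplexShape.down_Rel]; lia

variable [Abelian C] {M : C}

instance epi_augTo_zero (Q : ProjectiveResolution M) : Epi (augTo Q 0) :=
  inferInstanceAs (Epi (Q.π.f 0))

/-- A morphism out of the degree `0` term of a complex of projectives into the resolved object
extends to a chain map if it vanishes on boundaries. -/
lemma exists_chainMap (A : ChainComplex C ℕ) [∀ k, Projective (A.X k)]
    (Q : ProjectiveResolution M) (a : A.X 0 ⟶ M) (ha : A.d 1 0 ≫ a = 0) :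
    ∃ f : A ⟶ Q.complex, f.f 0 ≫ augTo Q 0 = a := by
  have h1 : (A.d 1 0 ≫ Projective.factorThru a (augTo Q 0)) ≫ augTo Q 0 = 0 := by
    rw [Category.assoc, Projective.factorThru_comp, ha]
  refine ⟨ChainComplex.mkHom _ _ (Projective.factorThru a (augTo Q 0))
    (Q.exact₀.liftFromProjective (A.d 1 0 ≫ Projective.factorThru a (augTo Q 0)) h1)
    (Q.exact₀.liftFromProjective_comp _ _) (fun n ⟨f, f', w⟩ =>
      ⟨(Q.exact_succ n).liftFromProjective (A.d (n + 2) (n + 1) ≫ f')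
        (by simp [w]), (Q.exact_succ n).liftFromProjective_comp _ _⟩), ?_⟩
  rw [ChainComplex.mkHom_f_0, Projective.factorThru_comp]

/-- A cocycle of degree `0` between projective resolutions of `M` which is compatible with the
augmentations is the identity up to a coboundary. -/
lemma exists_diff_eq_sub_id (Q : ProjectiveResolution M) {φ : Fam Q.complex Q.complex}
    (hφ : φ ∈ cochains Q.complex Q.complex 0) (hd : diff _ _ 0 φ = 0)
    (h0 : φ 0 0 ≫ augTo Q 0 = augTo Q 0) :
    ∃ κ ∈ cochains Q.complex Q.complex (-1), diff _ _ (-1) κ = φ - homFam (𝟙 Q.complex) := by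
  let f : Q.complex ⟶ Q.complex :=
    { f := fun p => φ p p
      comm' := by
        rintro _ q rfl
        have := congrFun (congrFun hd (q + 1)) q
        rw [diff_apply, Int.negOnePow_zero, one_smul] at this
        exact sub_eq_zero.1 this }
  have e : φ = homFam f := by
    funext p q
    by_cases h : p = q
    · subst h; rw [homFam_self]
    · rw [homFam_of_ne f h, hφ p q (by lia)]
  have H : Homotopy f (𝟙 _) := ProjectiveResolution.liftHomotopy (𝟙 M) f (𝟙 _)
    (by
      apply HomologicalComplex.to_single_hom_ext
      simpa using (show f.f 0 ≫ Q.π.f 0 = Q.π.f 0 from h0))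
    (by simp)
  rw [e]
  exact exists_diff_eq_of_homotopy H

end Comparison

/-! ### Equations in double complexes with exact rows -/

section DoubleComplex

variable {C : Type u} [Category.{v} C] [Preadditive C]

open Classical in
/-- A lift of `f` along `b`, chosen to be zero if `f` is zero or has no lift. -/
noncomputable def liftOrZero {T X Y : C} (b : X ⟶ Y) (f : T ⟶ Y) : T ⟶ X :=
  if h : f ≠ 0 ∧ ∃ g, g ≫ b = f then h.2.choose else 0

lemma liftOrZero_zero {T X Y : C} (b : X ⟶ Y) : liftOrZero b (0 : T ⟶ Y) = 0 :=
  dif_neg fun h => h.1 rfl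

lemma liftOrZero_comp {T X Y : C} (b : X ⟶ Y) (f : T ⟶ Y) (h : ∃ g, g ≫ b = f) :
    liftOrZero b f ≫ b = f := by
  by_cases hf : f = 0
  · rw [hf, liftOrZero_zero, zero_comp]
  · have H : f ≠ 0 ∧ ∃ g, g ≫ b = f := ⟨hf, h⟩
    rw [liftOrZero, dif_pos H]
    exact H.2.choose_spec

variable {T Y : ChainComplex C ℕ} {W : ℕ → ℕ → C} (A : ∀ i j, W (i + 1) j ⟶ W i j)
  (B : ∀ i j, W i (j + 1) ⟶ W i j) (ε : ∀ i, W i 0 ⟶ Y.X i)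

/-- The differential of degree `n` of families of morphisms from the terms of a complex to those
of a double complex with anticommuting differentials `A` and `B`. -/
def dblDiff (n : ℤ) (h : ∀ p i j : ℕ, T.X p ⟶ W i j) (p i j : ℕ) : T.X p ⟶ W i j :=
  h p (i + 1) j ≫ A i j + h p i (j + 1) ≫ B i j - n.negOnePow • (T.d p (p - 1) ≫ h (p - 1) i j)

/-- What remains for the `B`-part of `dblDiff n h = u` in the column `j`, given the column `j` of
`h`. -/
def dblRest (n : ℤ) (u : ∀ p i j : ℕ, T.X p ⟶ W i j) (j : ℕ)
    (h : ∀ p i : ℕ, T.X p ⟶ W i j) (p i : ℕ) : T.X p ⟶ W i j :=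
  u p i j - h p (i + 1) ≫ A i j + n.negOnePow • (T.d p (p - 1) ≫ h (p - 1) i)

/-- The columns of a solution `h` of `dblDiff n h = u` with `h ≫ ε = y`. -/
noncomputable def dblSolve (n : ℤ) (u : ∀ p i j : ℕ, T.X p ⟶ W i j) (y : Fam T Y) :
    ∀ j p i : ℕ, T.X p ⟶ W i j
  | 0 => fun p i => liftOrZero (ε i) (y p i)
  | j + 1 => fun p i => liftOrZero (B i j) (dblRest A n u j (dblSolve n u y j) p i)

lemma dblSolve_eq_zero {n : ℤ} {u : ∀ p i j : ℕ, T.X p ⟶ W i j} {y : Fam T Y}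
    (hu : ∀ p i j : ℕ, (p : ℤ) ≠ i + j + (n + 1) → u p i j = 0) (hy : y ∈ cochains T Y n)
    (j p i : ℕ) (h : (p : ℤ) ≠ i + j + n) : dblSolve A B ε n u y j p i = 0 := by
  induction j generalizing p i with
  | zero =>
    change liftOrZero (ε i) (y p i) = 0
    rw [hy p i (by simpa using h), liftOrZero_zero]
  | succ j ih =>
    change liftOrZero (B i j) (dblRest A n u j (dblSolve A B ε n u y j) p i) = 0
    rw [dblRest, hu p i j (by push_cast at h; lia), ih p (i + 1) (by push_cast at *; lia)]
    rcases p with _ | p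
    · rw [d_zero_zero]; simp [liftOrZero_zero]
    · rw [Nat.add_sub_cancel, ih p i (by push_cast at *; lia)]; simp [liftOrZero_zero]

/-- In a double complex with exact augmented rows, an equation `dblDiff n h = u` with prescribed
augmentation of `h` can be solved on complexes of projectives, if the necessary conditions hold. The
solution is found column by column; for the rows `i ≥ N` only the conditions on these rows
matter. -/
lemma exists_dblDiff_eq [∀ p, Projective (T.X p)]
    (hAA : ∀ i j, A (i + 1) j ≫ A i j = 0)
    (hAB : ∀ i j, A i (j + 1) ≫ B i j + B (i + 1) j ≫ A i j = 0)
    (hAε : ∀ i, A i 0 ≫ ε i = ε (i + 1) ≫ Y.d (i + 1) i)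
    (lε : ∀ i {P : C} [Projective P] (f : P ⟶ Y.X i), ∃ g, g ≫ ε i = f)
    (l0 : ∀ i {P : C} [Projective P] (f : P ⟶ W i 0), f ≫ ε i = 0 → ∃ g, g ≫ B i 0 = f)
    (ls : ∀ i j {P : C} [Projective P] (f : P ⟶ W i (j + 1)), f ≫ B i j = 0 →
      ∃ g, g ≫ B i (j + 1) = f)
    {n : ℤ} {N : ℕ} {u : ∀ p i j : ℕ, T.X p ⟶ W i j} {y : Fam T Y}
    (hu : ∀ p i j : ℕ, (p : ℤ) ≠ i + j + (n + 1) → u p i j = 0) (hy : y ∈ cochains T Y n)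
    (hdu : ∀ p i j, N ≤ i → dblDiff A B (n + 1) u p i j = 0)
    (huy : ∀ p i, N ≤ i → u p i 0 ≫ ε i = diff T Y n y p i) :
    ∃ h : ∀ p i j : ℕ, T.X p ⟶ W i j,
      (∀ p i j : ℕ, (p : ℤ) ≠ i + j + n → h p i j = 0) ∧
      (∀ p i, h p i 0 ≫ ε i = y p i) ∧
      ∀ p i j, N ≤ i → dblDiff A B n h p i j = u p i j := by
  have h0 : ∀ p i, dblSolve A B ε n u y 0 p i ≫ ε i = y p i := fun p i =>
    liftOrZero_comp _ _ (lε i _)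
  have key : ∀ j p i, N ≤ i → dblSolve A B ε n u y (j + 1) p i ≫ B i j =
      dblRest A n u j (dblSolve A B ε n u y j) p i := by
    intro j
    induction j with
    | zero =>
      intro p i hi
      refine liftOrZero_comp _ _ (l0 i _ ?_)
      rw [dblRest, Preadditive.add_comp, Preadditive.sub_comp, huy p i hi, Category.assoc, hAε,
        ← Category.assoc, h0, Linear.units_smul_comp, Category.assoc, h0, diff_apply]
      abel
    | succ j ih =>
      intro p i hi
      refine liftOrZero_comp _ _ (ls i j _ ?_)
      have e1 := ih p (i + 1) (by lia)
      have e2 := ih (p - 1) i hi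
      have e3 := eq_neg_of_add_eq_zero_left (hAB i j)
      have e4 := hdu p i j hi
      rw [dblDiff, Int.negOnePow_succ] at e4
      rw [dblRest, Preadditive.add_comp, Preadditive.sub_comp, Category.assoc, e3,
        Preadditive.comp_neg, ← Category.assoc, e1, Linear.units_smul_comp, Category.assoc, e2]
      simp only [dblRest, Preadditive.comp_add, Preadditive.add_comp, Preadditive.sub_comp,
        Preadditive.comp_sub, Category.assoc, hAA, comp_zero, Linear.units_smul_comp,
        Linear.comp_units_smul, HomologicalComplex.d_comp_d_assoc, zero_comp, smul_zero, smul_add,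
        smul_sub, Units.neg_smul] at e4 ⊢
      rw [← e4]
      abel
  refine ⟨fun p i j => dblSolve A B ε n u y j p i,
    fun p i j h => dblSolve_eq_zero A B ε hu hy j p i h, h0, fun p i j hi => ?_⟩
  rw [dblDiff, key j p i hi, dblRest]
  abel

end DoubleComplex

/-! ### Families with values in a tensor product -/

section DoubleFamilies

variable {C : Type u} [Category.{v} C] [Abelian C] [MonoidalCategory C]

/-- A family of morphisms `T_p ⟶ X_i ⊗ Y_j`: a family of morphisms from `T` to `X ⊗ Y`, given by
its components. -/
abbrev DFam (T X Y : ChainComplex C ℕ) : Type v := ∀ p i j : ℕ, T.X p ⟶ X.X i ⊗ Y.X j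

variable {S T X X' Y Y' : ChainComplex C ℕ}

/-- The families of degree `n`, whose only components are the `T_{i+j+n} ⟶ X_i ⊗ Y_j`. -/
def DFam.HasDegree (n : ℤ) (h : DFam T X Y) : Prop :=
  ∀ p i j : ℕ, (p : ℤ) ≠ i + j + n → h p i j = 0

/-- The differential of degree `n` of families of morphisms from `T` to `X ⊗ Y`. -/
def ddiff (n : ℤ) (h : DFam T X Y) : DFam T X Y :=
  dblDiff (fun i j => X.d (i + 1) i ▷ Y.X j)
    (fun i j => (i : ℤ).negOnePow • (X.X i ◁ Y.d (j + 1) j)) n h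

lemma ddiff_apply (n : ℤ) (h : DFam T X Y) (p i j : ℕ) :
    ddiff n h p i j = h p (i + 1) j ≫ X.d (i + 1) i ▷ Y.X j +
      (i : ℤ).negOnePow • (h p i (j + 1) ≫ X.X i ◁ Y.d (j + 1) j) -
      n.negOnePow • (T.d p (p - 1) ≫ h (p - 1) i j) := by
  rw [ddiff, dblDiff, Linear.comp_units_smul]

lemma ddiff_sub (n : ℤ) (h h' : DFam T X Y) : ddiff n (h - h') = ddiff n h - ddiff n h' := by
  funext p i j
  change _ = ddiff n h p i j - ddiff n h' p i j
  simp only [ddiff_apply, Pi.sub_apply, Preadditive.sub_comp, Preadditive.comp_sub, smul_sub]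
  abel

/-- The family `(φ ⊗ id) ∘ h`, where `φ` has degree `m`. -/
def actLeft (m : ℤ) (φ : Fam X X') (h : DFam T X Y) : DFam T X' Y := fun p i j =>
  h p ((i : ℤ) + m).toNat j ≫ φ ((i : ℤ) + m).toNat i ▷ Y.X j

/-- The family `(id ⊗ ψ) ∘ h`, where `ψ` has degree `n`, with the Koszul sign. -/
def actRight (n : ℤ) (ψ : Fam Y Y') (h : DFam T X Y) : DFam T X Y' := fun p i j =>
  ((i : ℤ) * n).negOnePow • (h p i ((j : ℤ) + n).toNat ≫ X.X i ◁ ψ ((j : ℤ) + n).toNat j)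

/-- The family `δ ∘ φ`, where `δ` has degree `0`. -/
def preComp (φ : Fam S T) (δ : DFam T X Y) : DFam S X Y := fun p i j =>
  φ p (i + j) ≫ δ (i + j) i j

lemma actLeft_sub (m : ℤ) (φ : Fam X X') (h h' : DFam T X Y) :
    actLeft m φ (h - h') = actLeft m φ h - actLeft m φ h' := by
  funext p i j
  exact Preadditive.sub_comp (C := C) (f := h p _ _) (f' := h' p _ _) (g := φ _ i ▷ Y.X j)

lemma preComp_hasDegree {m : ℤ} {φ : Fam S T} (hφ : φ ∈ cochains S T m) (δ : DFam T X Y) :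
    (preComp φ δ).HasDegree m := by
  intro p i j hp
  rw [preComp, hφ p (i + j) (by push_cast; lia), zero_comp]

lemma sub_hasDegree {m : ℤ} {h h' : DFam T X Y} (hh : h.HasDegree m) (hh' : h'.HasDegree m) :
    (h - h').HasDegree m := fun p i j hp => by
  change h p i j - h' p i j = 0
  rw [hh p i j hp, hh' p i j hp, sub_zero]

lemma ddiff_preComp {m : ℤ} (φ : Fam S T) {δ : DFam T X Y} (hδ : ddiff 0 δ = 0) :
    ddiff m (preComp φ δ) = preComp (diff S T m φ) δ := by
  funext p i j
  have e : i + 1 + j = i + j + 1 := by lia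
  have e1 : preComp φ δ p (i + 1) j = φ p (i + j + 1) ≫ δ (i + j + 1) (i + 1) j := by
    rw [preComp, e]
  have hd := congrFun (congrFun (congrFun hδ (i + j + 1)) i) j
  rw [ddiff_apply, Int.negOnePow_zero, one_smul, Nat.add_sub_cancel] at hd
  have hd := sub_eq_zero.1 hd
  rw [ddiff_apply, e1]
  simp only [preComp, diff_apply, Category.assoc, Preadditive.sub_comp, Linear.units_smul_comp]
  rw [← hd, Preadditive.comp_add, Linear.comp_units_smul]
  rfl

lemma actLeft_id (h : DFam T X Y) : actLeft 0 (homFam (𝟙 X)) h = h := by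
  funext p i j
  have e : ((i : ℤ) + 0).toNat = i := by lia
  rw [actLeft, e, homFam_self, HomologicalComplex.id_f, id_whiskerRight, Category.comp_id]

lemma actRight_id (h : DFam T X Y) : actRight 0 (homFam (𝟙 Y)) h = h := by
  funext p i j
  have e : ((j : ℤ) + 0).toNat = j := by lia
  rw [actRight, e, homFam_self, HomologicalComplex.id_f, MonoidalCategory.whiskerLeft_id,
    Category.comp_id, mul_zero, Int.negOnePow_zero, one_smul]

variable [MonoidalPreadditive C]

lemma actLeft_hasDegree {m n k : ℤ} (hk : m + n = k) {φ : Fam X X'} (hφ : φ ∈ cochains X X' m)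
    {h : DFam T X Y} (hh : h.HasDegree n) : (actLeft m φ h).HasDegree k := by
  intro p i j hp
  rw [actLeft]
  by_cases h0 : 0 ≤ (i : ℤ) + m
  · rw [hh p _ j (by lia), zero_comp]
  · rw [hφ _ i (by lia), MonoidalPreadditive.zero_whiskerRight, comp_zero]

lemma actRight_hasDegree {m n k : ℤ} (hk : m + n = k) {φ : Fam Y Y'} (hφ : φ ∈ cochains Y Y' m)
    {h : DFam T X Y} (hh : h.HasDegree n) : (actRight m φ h).HasDegree k := by
  intro p i j hp
  rw [actRight]
  by_cases h0 : 0 ≤ (j : ℤ) + m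
  · rw [hh p i _ (by lia), zero_comp, smul_zero]
  · rw [hφ _ j (by lia), MonoidalPreadditive.whiskerLeft_zero, comp_zero, smul_zero]

lemma sub_units_smul_whiskerRight {U V : C} (f g : U ⟶ V) (s : ℤˣ) (Z : C) :
    (f - s • g) ▷ Z = f ▷ Z - s • (g ▷ Z) := by
  rcases Int.units_eq_one_or s with h | h <;> subst h
  · rw [one_smul, one_smul]
    exact (tensorRight Z).map_sub
  · rw [Units.neg_smul, one_smul, Units.neg_smul, one_smul, sub_neg_eq_add, sub_neg_eq_add,
      MonoidalPreadditive.add_whiskerRight]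

lemma whiskerLeft_sub_units_smul {U V : C} (f g : U ⟶ V) (s : ℤˣ) (Z : C) :
    Z ◁ (f - s • g) = Z ◁ f - s • (Z ◁ g) := by
  rcases Int.units_eq_one_or s with h | h <;> subst h
  · rw [one_smul, one_smul]
    exact (tensorLeft Z).map_sub
  · rw [Units.neg_smul, one_smul, Units.neg_smul, one_smul, sub_neg_eq_add, sub_neg_eq_add,
      MonoidalPreadditive.whiskerLeft_add]

/-- Leibniz rule for the action of a family on the first factor. -/
lemma ddiff_actLeft {m n k : ℤ} (hk : m + n = k) {φ : Fam X X'} (hφ : φ ∈ cochains X X' m)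
    (h : DFam T X Y) :
    ddiff k (actLeft m φ h) =
      actLeft (m + 1) (diff X X' m φ) h + m.negOnePow • actLeft m φ (ddiff n h) := by
  subst hk
  funext p i j
  change _ = actLeft (m + 1) (diff X X' m φ) h p i j + m.negOnePow • actLeft m φ (ddiff n h) p i j
  have e : ((i + 1 : ℕ) : ℤ) + m = (i : ℤ) + (m + 1) := by push_cast; ring
  have key : h p ((i : ℤ) + (m + 1)).toNat j ≫
        X.d ((i : ℤ) + (m + 1)).toNat (((i : ℤ) + (m + 1)).toNat - 1) ▷ Y.X j ≫
          φ (((i : ℤ) + (m + 1)).toNat - 1) i ▷ Y.X j =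
      h p (((i : ℤ) + m).toNat + 1) j ≫
        X.d (((i : ℤ) + m).toNat + 1) ((i : ℤ) + m).toNat ▷ Y.X j ≫
          φ ((i : ℤ) + m).toNat i ▷ Y.X j := by
    by_cases h0 : 0 ≤ (i : ℤ) + m
    · have : ((i : ℤ) + (m + 1)).toNat = ((i : ℤ) + m).toNat + 1 := by lia
      rw [this, Nat.add_sub_cancel]
    · have h1 : ((i : ℤ) + (m + 1)).toNat = 0 := by lia
      have h2 : φ ((i : ℤ) + m).toNat i = 0 := hφ _ i (by lia)
      rw [h1, d_zero_zero, h2]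
      simp
  have key2 : (((((i : ℤ) + m).toNat : ℕ) : ℤ)).negOnePow •
        (h p ((i : ℤ) + m).toNat (j + 1) ≫ X.X _ ◁ Y.d (j + 1) j ≫
          φ ((i : ℤ) + m).toNat i ▷ Y.X j) =
      ((i : ℤ) + m).negOnePow •
        (h p ((i : ℤ) + m).toNat (j + 1) ≫ X.X _ ◁ Y.d (j + 1) j ≫
          φ ((i : ℤ) + m).toNat i ▷ Y.X j) := by
    by_cases h0 : 0 ≤ (i : ℤ) + m
    · rw [Int.toNat_of_nonneg h0]
    · rw [hφ _ i (by lia)]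
      simp
  have e' : h p (((i + 1 : ℕ) : ℤ) + m).toNat j ≫ φ (((i + 1 : ℕ) : ℤ) + m).toNat (i + 1) ▷ Y.X j =
      h p ((i : ℤ) + (m + 1)).toNat j ≫ φ ((i : ℤ) + (m + 1)).toNat (i + 1) ▷ Y.X j := by rw [e]
  rw [ddiff_apply]
  simp only [actLeft]
  rw [e']
  simp only [diff_apply, ddiff_apply, sub_units_smul_whiskerRight, comp_whiskerRight,
    Preadditive.comp_sub, Preadditive.sub_comp,
    Preadditive.add_comp, Category.assoc, Linear.units_smul_comp, Linear.comp_units_smul,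
    smul_add, smul_sub, key, key2, ← whisker_exchange]
  simp only [smul_smul, ← Int.negOnePow_add]
  rw [show (m + (i + m)).negOnePow = (i : ℤ).negOnePow from
    (Int.negOnePow_eq_iff _ _).2 ⟨m, by ring⟩]
  abel

/-- Leibniz rule for the action of a family on the second factor. -/
lemma ddiff_actRight {m n k : ℤ} (hk : m + n = k) {ψ : Fam Y Y'} (hψ : ψ ∈ cochains Y Y' m)
    (h : DFam T X Y) :
    ddiff k (actRight m ψ h) =
      actRight (m + 1) (diff Y Y' m ψ) h + m.negOnePow • actRight m ψ (ddiff n h) := by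
  subst hk
  funext p i j
  change _ = actRight (m + 1) (diff Y Y' m ψ) h p i j +
    m.negOnePow • actRight m ψ (ddiff n h) p i j
  have e : ((j + 1 : ℕ) : ℤ) + m = (j : ℤ) + (m + 1) := by push_cast; ring
  have key : h p i ((j : ℤ) + (m + 1)).toNat ≫
        X.X i ◁ Y.d ((j : ℤ) + (m + 1)).toNat (((j : ℤ) + (m + 1)).toNat - 1) ≫
          X.X i ◁ ψ (((j : ℤ) + (m + 1)).toNat - 1) j =
      h p i (((j : ℤ) + m).toNat + 1) ≫
        X.X i ◁ Y.d (((j : ℤ) + m).toNat + 1) ((j : ℤ) + m).toNat ≫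
          X.X i ◁ ψ ((j : ℤ) + m).toNat j := by
    by_cases h0 : 0 ≤ (j : ℤ) + m
    · have : ((j : ℤ) + (m + 1)).toNat = ((j : ℤ) + m).toNat + 1 := by lia
      rw [this, Nat.add_sub_cancel]
    · have h1 : ((j : ℤ) + (m + 1)).toNat = 0 := by lia
      have h2 : ψ ((j : ℤ) + m).toNat j = 0 := hψ _ j (by lia)
      rw [h1, d_zero_zero, h2]
      simp
  have e' : h p i (((j + 1 : ℕ) : ℤ) + m).toNat ≫ X.X i ◁ ψ (((j + 1 : ℕ) : ℤ) + m).toNat (j + 1) =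
      h p i ((j : ℤ) + (m + 1)).toNat ≫ X.X i ◁ ψ ((j : ℤ) + (m + 1)).toNat (j + 1) := by rw [e]
  rw [ddiff_apply]
  simp only [actRight]
  rw [e']
  simp only [diff_apply, ddiff_apply, whiskerLeft_sub_units_smul,
    MonoidalCategory.whiskerLeft_comp, Preadditive.comp_sub, Preadditive.sub_comp,
    Preadditive.add_comp, Category.assoc, Linear.units_smul_comp, Linear.comp_units_smul,
    smul_add, smul_sub, key, whisker_exchange]
  simp only [smul_smul, ← Int.negOnePow_add]
  rw [show (m + (i * m + i)).negOnePow = (i * (m + 1) + m : ℤ).negOnePow from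
      (Int.negOnePow_eq_iff _ _).2 ⟨0, by ring⟩,
    show (m + n + i * m).negOnePow = (m + (i * m + n) : ℤ).negOnePow from
      (Int.negOnePow_eq_iff _ _).2 ⟨0, by ring⟩,
    show (((i + 1 : ℕ) : ℤ) * m).negOnePow = (m + i * m : ℤ).negOnePow from
      (Int.negOnePow_eq_iff _ _).2 ⟨0, by push_cast; ring⟩,
    show (i + i * m : ℤ).negOnePow = (i * (m + 1) : ℤ).negOnePow from
      (Int.negOnePow_eq_iff _ _).2 ⟨0, by ring⟩]
  abel

/-! ### Projection of families to the complexes `P ⊗ᵒ Q` -/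

variable {M N : C} (o : ℕ → Bool) (P : ProjectiveResolution M) (Q : ProjectiveResolution N)

/-- The composite of a family of morphisms from `T` to `P ⊗ Q` with the projection of `P ⊗ Q` to
`P ⊗ᵒ Q`. -/
noncomputable def pathFam : DFam T P.complex Q.complex →+ Fam T (pathComplex o P Q) :=
  AddMonoidHom.mk' (fun h p k => h p (pCount o k) (dCount o k) ≫ pathQuot o P Q k)
    (fun h h' => funext fun p => funext fun k =>
      Preadditive.add_comp _ _ _ (h p _ _) (h' p _ _) (pathQuot o P Q k))

/-- Compatibility of the projection onto one term of `P ⊗ᵒ Q` with the differentials, one step of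
the path at a time. -/
lemma stepQuot_comp (b : Bool) (i j : ℕ) {U : C}
    (h : ∀ i j : ℕ, U ⟶ P.complex.X i ⊗ Q.complex.X j) :
    h (pStep b i) (dStep b j) ≫ (syzygyπ P (pStep b i) ⊗ₘ syzygyπ Q (dStep b j)) ≫
        stepι P Q b i j =
      (h (i + 1) j ≫ P.complex.d (i + 1) i ▷ Q.complex.X j +
        (i : ℤ).negOnePow • (h i (j + 1) ≫ P.complex.X i ◁ Q.complex.d (j + 1) j)) ≫
        stepQuot P Q b i j := by
  cases b
  · change h i (j + 1) ≫ (syzygyπ P i ⊗ₘ syzygyπ Q (j + 1)) ≫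
      ((i : ℤ).negOnePow • (syzygy P i ◁ syzygyι Q j)) = _ ≫ syzygyπ P i ▷ Q.complex.X j
    rw [Preadditive.add_comp, Category.assoc, ← comp_whiskerRight, d_syzygyπ,
      MonoidalPreadditive.zero_whiskerRight, comp_zero, zero_add, Linear.comp_units_smul,
      Linear.comp_units_smul, Linear.units_smul_comp, MonoidalCategory.tensorHom_def, Category.assoc, Category.assoc,
      ← MonoidalCategory.whiskerLeft_comp, syzygyπ_ι, whisker_exchange]
  · change h (i + 1) j ≫ (syzygyπ P (i + 1) ⊗ₘ syzygyπ Q j) ≫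
      (syzygyι P i ▷ syzygy Q j) = _ ≫ P.complex.X i ◁ syzygyπ Q j
    rw [Preadditive.add_comp, Linear.units_smul_comp, Category.assoc, Category.assoc,
      ← MonoidalCategory.whiskerLeft_comp, d_syzygyπ,
      MonoidalPreadditive.whiskerLeft_zero, comp_zero, smul_zero, add_zero, MonoidalCategory.tensorHom_def',
      Category.assoc, ← comp_whiskerRight, syzygyπ_ι, whisker_exchange]

lemma diff_pathFam (n : ℤ) (h : DFam T P.complex Q.complex) :
    diff T (pathComplex o P Q) n (pathFam o P Q h) = pathFam o P Q (ddiff n h) := by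
  funext p k
  have h0 : diff T (pathComplex o P Q) n (pathFam o P Q h) p k =
      (h p _ _ ≫ pathQuot o P Q (k + 1)) ≫ (pathπ o P Q (k + 1) ≫ pathι o P Q k) -
        n.negOnePow • (T.d p (p - 1) ≫ h (p - 1) _ _ ≫ pathQuot o P Q k) :=
    congrArg (fun t : pathX o P Q (k + 1) ⟶ pathX o P Q k =>
      (h p _ _ ≫ pathQuot o P Q (k + 1)) ≫ t -
        n.negOnePow • (T.d p (p - 1) ≫ h (p - 1) _ _ ≫ pathQuot o P Q k)) (pathComplex_d o P Q k)
  have h1 : pathQuot o P Q (k + 1) ≫ pathπ o P Q (k + 1) =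
      (syzygyπ P (pCount o (k + 1)) ⊗ₘ syzygyπ Q (dCount o (k + 1))) :=
    stepQuot_π P Q _ _ _
  have h2 := stepQuot_comp P Q (o k) (pCount o k) (dCount o k) (h p)
  have h3 : (h p _ _ ≫ pathQuot o P Q (k + 1)) ≫ (pathπ o P Q (k + 1) ≫ pathι o P Q k) -
        n.negOnePow • (T.d p (p - 1) ≫ h (p - 1) _ _ ≫ pathQuot o P Q k) =
      ddiff n h p _ _ ≫ pathQuot o P Q k := by
    rw [ddiff_apply, Preadditive.sub_comp, Linear.units_smul_comp, Category.assoc, Category.assoc]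
    congr 1
    rw [← Category.assoc (pathQuot o P Q (k + 1)), h1]
    exact h2
  exact h0.trans h3

variable {o P Q} in
lemma pathFam_eq_zero {h : DFam T P.complex Q.complex} {p k : ℕ}
    (hh : h p (pCount o k) (dCount o k) = 0) : pathFam o P Q h p k = 0 :=
  (congrArg (· ≫ pathQuot o P Q k) hh).trans zero_comp

lemma pathFam_mem_cochains {n : ℤ} {h : DFam T P.complex Q.complex} (hh : h.HasDegree n) :
    pathFam o P Q h ∈ cochains T (pathComplex o P Q) n := by
  intro p k hp
  have := pCount_add_dCount o k
  exact pathFam_eq_zero (hh p _ _ (by lia))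

variable {o}

lemma pathFam_mem_bounded_left (ho : IsPath o) {h : DFam T P.complex Q.complex} {K : ℕ}
    (hh : ∀ p i j, K ≤ i → h p i j = 0) : pathFam o P Q h ∈ bounded T (pathComplex o P Q) := by
  obtain ⟨L, hL⟩ := ho.le_pCount K
  exact ⟨L, fun p k hk => pathFam_eq_zero (hh _ _ _ (hL k hk))⟩

lemma pathFam_mem_bounded_right (ho : IsPath o) {h : DFam T P.complex Q.complex} {K : ℕ}
    (hh : ∀ p i j, K ≤ j → h p i j = 0) : pathFam o P Q h ∈ bounded T (pathComplex o P Q) := by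
  obtain ⟨L, hL⟩ := ho.le_dCount K
  exact ⟨L, fun p k hk => pathFam_eq_zero (hh _ _ _ (hL k hk))⟩

end DoubleFamilies

/-! ### Tensoring with a resolution of the unit -/

section TensorExact

variable {C : Type u} [Category.{v} C] [Abelian C] [MonoidalCategory C]
  {R : C} {P : ProjectiveResolution R}

variable (P) in
/-- The augmentation of a resolution of an object isomorphic to the monoidal unit, with values in
the unit. -/
noncomputable def unitAug (e : R ≅ 𝟙_ C) : P.complex.X 0 ⟶ 𝟙_ C := augTo P 0 ≫ e.hom

variable (P) in
/-- The map `X ⊗ P₀ ⟶ X` induced by the augmentation of `P`. -/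
noncomputable def augRight (e : R ≅ 𝟙_ C) (X : C) : X ⊗ P.complex.X 0 ⟶ X :=
  X ◁ unitAug P e ≫ (ρ_ X).hom

variable (P) in
/-- The map `P₀ ⊗ X ⟶ X` induced by the augmentation of `P`. -/
noncomputable def augLeft (e : R ≅ 𝟙_ C) (X : C) : P.complex.X 0 ⊗ X ⟶ X :=
  unitAug P e ▷ X ≫ (λ_ X).hom

lemma d_unitAug (e : R ≅ 𝟙_ C) : P.complex.d 1 0 ≫ unitAug P e = 0 := by
  rw [unitAug, ← Category.assoc]
  exact (congrArg (· ≫ e.hom) (d_augD P 0)).trans zero_comp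

lemma augRight_naturality (e : R ≅ 𝟙_ C) {X X' : C} (f : X ⟶ X') :
    f ▷ P.complex.X 0 ≫ augRight P e X' = augRight P e X ≫ f := by
  rw [augRight, augRight, ← whisker_exchange_assoc, rightUnitor_naturality, Category.assoc]

lemma augLeft_naturality (e : R ≅ 𝟙_ C) {X X' : C} (f : X ⟶ X') :
    P.complex.X 0 ◁ f ≫ augLeft P e X' = augLeft P e X ≫ f := by
  rw [augLeft, augLeft, whisker_exchange_assoc, leftUnitor_naturality, Category.assoc]

variable (P) in
lemma exists_augRight_eq (e : R ≅ 𝟙_ C) (X : C) :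
    ∃ f : X ⊗ syzygy P 0 ≅ X, augRight P e X = X ◁ syzygyπ P 0 ≫ f.hom := by
  refine ⟨whiskerLeftIso X (show syzygy P 0 ≅ 𝟙_ C from e) ≪≫ ρ_ X, ?_⟩
  rw [Iso.trans_hom, whiskerLeftIso_hom, ← Category.assoc, ← MonoidalCategory.whiskerLeft_comp]
  rfl

variable (P) in
lemma exists_augLeft_eq (e : R ≅ 𝟙_ C) (X : C) :
    ∃ f : syzygy P 0 ⊗ X ≅ X, augLeft P e X = syzygyπ P 0 ▷ X ≫ f.hom := by
  refine ⟨whiskerRightIso (show syzygy P 0 ≅ 𝟙_ C from e) X ≪≫ λ_ X, ?_⟩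
  rw [Iso.trans_hom, whiskerRightIso_hom, ← Category.assoc, ← comp_whiskerRight]
  rfl

lemma augRight_unitAug : augRight P e (P.complex.X 0) ≫ unitAug P e =
    augLeft P e (P.complex.X 0) ≫ unitAug P e := by
  rw [augRight, augLeft, Category.assoc, Category.assoc, ← rightUnitor_naturality,
    ← leftUnitor_naturality, ← whisker_exchange_assoc, unitors_equal]

variable [MonoidalPreadditive C]

lemma whiskerLeft_d_augRight (e : R ≅ 𝟙_ C) (X : C) :
    X ◁ P.complex.d 1 0 ≫ augRight P e X = 0 := by
  rw [augRight, ← Category.assoc, ← MonoidalCategory.whiskerLeft_comp, d_unitAug,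
    MonoidalPreadditive.whiskerLeft_zero, zero_comp]

lemma d_whiskerRight_augLeft (e : R ≅ 𝟙_ C) (X : C) :
    P.complex.d 1 0 ▷ X ≫ augLeft P e X = 0 := by
  rw [augLeft, ← Category.assoc, ← comp_whiskerRight, d_unitAug,
    MonoidalPreadditive.zero_whiskerRight, zero_comp]

/-- Tensoring with any object, from either side, keeps the short exact sequences exact of which the
resolution is spliced. -/
structure TensorExact (P : ProjectiveResolution R) : Prop where
  left : ∀ (X : C) (k : ℕ), ((syzygySeq P k).map (tensorLeft X)).ShortExact
  right : ∀ (X : C) (k : ℕ), ((syzygySeq P k).map (tensorRight X)).ShortExact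

variable (hP : TensorExact P)

include hP

lemma TensorExact.exists_lift_left {X T : C} [Projective T] {k : ℕ} (f : T ⟶ X ⊗ P.complex.X k)
    (hf : f ≫ X ◁ syzygyπ P k = 0) : ∃ g, g ≫ X ◁ P.complex.d (k + 1) k = f := by
  have : Epi (X ◁ syzygyπ P (k + 1)) := (hP.left X (k + 1)).epi_g
  have := (hP.left X k).mono_f
  obtain ⟨a, ha⟩ : ∃ a : T ⟶ X ⊗ syzygy P (k + 1), a ≫ X ◁ syzygyι P k = f :=
    (hP.left X k).exact.lift' f hf
  refine ⟨Projective.factorThru a (X ◁ syzygyπ P (k + 1)), ?_⟩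
  rw [← syzygyπ_ι, MonoidalCategory.whiskerLeft_comp, Projective.factorThru_comp_assoc, ha]

lemma TensorExact.exists_lift_right {X T : C} [Projective T] {k : ℕ} (f : T ⟶ P.complex.X k ⊗ X)
    (hf : f ≫ syzygyπ P k ▷ X = 0) : ∃ g, g ≫ P.complex.d (k + 1) k ▷ X = f := by
  have : Epi (syzygyπ P (k + 1) ▷ X) := (hP.right X (k + 1)).epi_g
  have := (hP.right X k).mono_f
  obtain ⟨a, ha⟩ : ∃ a : T ⟶ syzygy P (k + 1) ⊗ X, a ≫ syzygyι P k ▷ X = f :=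
    (hP.right X k).exact.lift' f hf
  refine ⟨Projective.factorThru a (syzygyπ P (k + 1) ▷ X), ?_⟩
  rw [← syzygyπ_ι, comp_whiskerRight, Projective.factorThru_comp_assoc, ha]

lemma TensorExact.comp_syzygyπ_left {X T : C} {k : ℕ} (f : T ⟶ X ⊗ P.complex.X (k + 1))
    (hf : f ≫ X ◁ P.complex.d (k + 1) k = 0) : f ≫ X ◁ syzygyπ P (k + 1) = 0 := by
  have : Mono (X ◁ syzygyι P k) := (hP.left X k).mono_f
  rw [← cancel_mono (X ◁ syzygyι P k), Category.assoc, ← MonoidalCategory.whiskerLeft_comp,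
    syzygyπ_ι, hf, zero_comp]

lemma TensorExact.comp_syzygyπ_right {X T : C} {k : ℕ} (f : T ⟶ P.complex.X (k + 1) ⊗ X)
    (hf : f ≫ P.complex.d (k + 1) k ▷ X = 0) : f ≫ syzygyπ P (k + 1) ▷ X = 0 := by
  have : Mono (syzygyι P k ▷ X) := (hP.right X k).mono_f
  rw [← cancel_mono (syzygyι P k ▷ X), Category.assoc, ← comp_whiskerRight,
    syzygyπ_ι, hf, zero_comp]

lemma TensorExact.epi_augRight (e : R ≅ 𝟙_ C) (X : C) : Epi (augRight P e X) := by
  have : Epi (X ◁ syzygyπ P 0) := (hP.left X 0).epi_g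
  obtain ⟨f, hf⟩ := exists_augRight_eq P e X
  rw [hf]
  exact epi_comp _ _

lemma TensorExact.epi_augLeft (e : R ≅ 𝟙_ C) (X : C) : Epi (augLeft P e X) := by
  have : Epi (syzygyπ P 0 ▷ X) := (hP.right X 0).epi_g
  obtain ⟨f, hf⟩ := exists_augLeft_eq P e X
  rw [hf]
  exact epi_comp _ _

variable {T X : ChainComplex C ℕ} [∀ p, Projective (T.X p)] {n : ℤ} {N : ℕ}

/-- Equations for families of morphisms to `X ⊗ P` can be solved on complexes of projectives, because
`X ⊗ P` is a resolution of `X`. -/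
lemma TensorExact.exists_ddiff_eq_right (e : R ≅ 𝟙_ C) {u : DFam T X P.complex} {y : Fam T X}
    (hu : u.HasDegree (n + 1)) (hy : y ∈ cochains T X n)
    (hdu : ∀ p i j, N ≤ i → ddiff (n + 1) u p i j = 0)
    (huy : ∀ p i, N ≤ i → u p i 0 ≫ augRight P e (X.X i) = diff T X n y p i) :
    ∃ h : DFam T X P.complex, h.HasDegree n ∧ (∀ p i, h p i 0 ≫ augRight P e (X.X i) = y p i) ∧
      ∀ p i j, N ≤ i → ddiff n h p i j = u p i j := by
  refine exists_dblDiff_eq (Y := X) (W := fun i j => X.X i ⊗ P.complex.X j) _ _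
    (fun i => augRight P e (X.X i))
    (fun i j => ?_) (fun i j => ?_) (fun i => ?_) (fun i U _ f => ?_) (fun i U _ f hf => ?_)
    (fun i j U _ f hf => ?_) hu hy hdu huy
  · rw [← comp_whiskerRight, HomologicalComplex.d_comp_d, MonoidalPreadditive.zero_whiskerRight]
  · rw [Linear.comp_units_smul, Linear.units_smul_comp, whisker_exchange, Nat.cast_succ,
      Int.negOnePow_succ, Units.neg_smul, add_neg_cancel]
  · exact augRight_naturality e _
  · have := hP.epi_augRight e (X.X i)
    exact ⟨Projective.factorThru f _, Projective.factorThru_comp _ _⟩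
  · obtain ⟨s, hs⟩ := exists_augRight_eq P e (X.X i)
    rw [hs, ← Category.assoc] at hf
    obtain ⟨g, hg⟩ := hP.exists_lift_left f ((cancel_mono _).1 (hf.trans zero_comp.symm))
    refine ⟨(i : ℤ).negOnePow • g, ?_⟩
    rw [Linear.comp_units_smul, Linear.units_smul_comp, smul_smul, Int.units_mul_self, one_smul, hg]
  · rw [Linear.comp_units_smul, smul_eq_zero_iff_eq] at hf
    obtain ⟨g, hg⟩ := hP.exists_lift_left f (hP.comp_syzygyπ_left f hf)
    refine ⟨(i : ℤ).negOnePow • g, ?_⟩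
    rw [Linear.comp_units_smul, Linear.units_smul_comp, smul_smul, Int.units_mul_self, one_smul, hg]

/-- Equations for families of morphisms to `P ⊗ X` can be solved on complexes of projectives, because
`P ⊗ X` is a resolution of `X`. -/
lemma TensorExact.exists_ddiff_eq_left (e : R ≅ 𝟙_ C) {u : DFam T P.complex X} {y : Fam T X}
    (hu : u.HasDegree (n + 1)) (hy : y ∈ cochains T X n)
    (hdu : ∀ p i j, N ≤ j → ddiff (n + 1) u p i j = 0)
    (huy : ∀ p j, N ≤ j → u p 0 j ≫ augLeft P e (X.X j) = diff T X n y p j) :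
    ∃ h : DFam T P.complex X, h.HasDegree n ∧ (∀ p j, h p 0 j ≫ augLeft P e (X.X j) = y p j) ∧
      ∀ p i j, N ≤ j → ddiff n h p i j = u p i j := by
  have hd : ∀ (n : ℤ) (h : ∀ p j i : ℕ, T.X p ⟶ P.complex.X i ⊗ X.X j) (p i j : ℕ),
      dblDiff (W := fun j i => P.complex.X i ⊗ X.X j)
        (fun j i => (i : ℤ).negOnePow • (P.complex.X i ◁ X.d (j + 1) j))
        (fun j i => P.complex.d (i + 1) i ▷ X.X j) n h p j i =
      ddiff n (fun p i j => h p j i) p i j := by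
    intro n h p i j
    rw [ddiff_apply, dblDiff, Linear.comp_units_smul,
      add_comm (h p j (i + 1) ≫ P.complex.d (i + 1) i ▷ X.X j)]
  refine (exists_dblDiff_eq (Y := X) (W := fun j i => P.complex.X i ⊗ X.X j)
    (fun j i => (i : ℤ).negOnePow • (P.complex.X i ◁ X.d (j + 1) j))
    (fun j i => P.complex.d (i + 1) i ▷ X.X j) (fun j => augLeft P e (X.X j))
    (fun i j => ?_) (fun i j => ?_) (fun i => ?_) (fun i U _ f => ?_) (fun i U _ f hf => ?_)
    (fun i j U _ f hf => ?_) (u := fun p j i => u p i j) (N := N)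
    (fun p j i hp => hu p i j (by lia)) hy
    (fun p j i hj => (hd _ _ p i j).trans (hdu p i j hj)) huy).elim fun h hh =>
      ⟨fun p i j => h p j i, fun p i j hp => hh.1 p j i (by lia), hh.2.1,
        fun p i j hj => (hd n h p i j).symm.trans (hh.2.2 p j i hj)⟩
  · rw [Linear.comp_units_smul, Linear.units_smul_comp, ← MonoidalCategory.whiskerLeft_comp,
      HomologicalComplex.d_comp_d, MonoidalPreadditive.whiskerLeft_zero, smul_zero, smul_zero]
  · rw [Linear.comp_units_smul, Linear.units_smul_comp, whisker_exchange, Nat.cast_succ,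
      Int.negOnePow_succ, Units.neg_smul, neg_add_cancel]
  · rw [Nat.cast_zero, Int.negOnePow_zero, one_smul]
    exact augLeft_naturality e _
  · have := hP.epi_augLeft e (X.X i)
    exact ⟨Projective.factorThru f _, Projective.factorThru_comp _ _⟩
  · obtain ⟨s, hs⟩ := exists_augLeft_eq P e (X.X i)
    rw [hs, ← Category.assoc] at hf
    exact hP.exists_lift_right f ((cancel_mono _).1 (hf.trans zero_comp.symm))
  · exact hP.exists_lift_right f (hP.comp_syzygyπ_right f hf)

end TensorExact

/-! ### Composition of families modulo almost coboundaries -/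

section Composition

variable {C : Type u} [Category.{v} C] [Preadditive C] {A B D E : ChainComplex C ℕ}

lemma map_units_smul {X Y : Type*} [AddCommGroup X] [AddCommGroup Y] (f : X →+ Y) (s : ℤˣ)
    (x : X) : f (s • x) = s • f x := by
  rcases Int.units_eq_one_or s with h | h <;> rw [h]
  · rw [one_smul, one_smul]
  · rw [Units.neg_smul, one_smul, map_neg, Units.neg_smul, one_smul]

lemma comp_homFam_id {n : ℤ} {φ : Fam A B} (hφ : φ ∈ cochains A B n) :
    comp n φ (homFam (𝟙 A)) = φ := by
  funext p q
  rw [comp_apply]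
  by_cases h : p = ((q : ℤ) + n).toNat
  · rw [← h, homFam_self, HomologicalComplex.id_f, Category.id_comp]
  · rw [homFam_of_ne _ h, zero_comp, hφ p q (by lia)]

lemma homFam_id_comp (φ : Fam A B) : comp 0 (homFam (𝟙 B)) φ = φ := by
  funext p q
  have h : ((q : ℤ) + 0).toNat = q := by lia
  rw [comp_apply, h, homFam_self, HomologicalComplex.id_f, Category.comp_id]

lemma comp_assoc {a b c : ℤ} (hc : a + b = c) {χ : Fam D E} (hχ : χ ∈ cochains D E a)
    (ψ : Fam B D) (φ : Fam A B) : comp c (comp a χ ψ) φ = comp a χ (comp b ψ φ) := by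
  subst hc
  funext p r
  simp only [comp_apply, Category.assoc]
  by_cases h : 0 ≤ (r : ℤ) + a
  · have e : ((((r : ℤ) + a).toNat : ℕ) : ℤ) + b = r + (a + b) := by lia
    rw [e]
  · rw [hχ _ r (by lia)]
    simp

lemma CExt.mk_eq_mk {n : ℤ} {φ ψ : Fam A B} (hφ : φ ∈ almostCocycles A B n)
    (hψ : ψ ∈ almostCocycles A B n) (h : φ - ψ ∈ almostCoboundaries A B n) :
    CExt.mk φ hφ = CExt.mk ψ hψ := by
  refine (QuotientAddGroup.eq_iff_sub_mem).2 ?_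
  exact h

lemma sub_mem_almostCoboundaries_trans {n : ℤ} {φ ψ χ : Fam A B}
    (h : φ - ψ ∈ almostCoboundaries A B n) (h' : ψ - χ ∈ almostCoboundaries A B n) :
    φ - χ ∈ almostCoboundaries A B n := by
  have := add_mem h h'
  rwa [sub_add_sub_cancel] at this

lemma diff_mem_almostCoboundaries {n : ℤ} {φ : Fam A B} (hφ : φ ∈ cochains A B (n - 1)) :
    diff A B (n - 1) φ ∈ almostCoboundaries A B n :=
  ⟨(diff_mem_almostCocycles hφ).1, AddSubgroup.mem_sup_left ⟨φ, hφ, rfl⟩⟩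

/-- A family which is the identity up to a coboundary acts as the identity on classes. -/
lemma comp_sub_mem_almostCoboundaries {n : ℤ} {χ : Fam B B} {κ : Fam B B}
    (hκ : κ ∈ cochains B B (-1)) (h : diff B B (-1) κ = χ - homFam (𝟙 B)) {φ : Fam A B}
    (hφ : φ ∈ almostCocycles A B n) : comp 0 χ φ - φ ∈ almostCoboundaries A B n := by
  have h1 : comp 0 χ φ - φ = comp 0 (diff B B (0 - 1) κ) φ := by
    rw [zero_sub, h, map_sub, AddMonoidHom.sub_apply, homFam_id_comp]
  rw [h1]
  exact comp_mem_almostCoboundaries_left (zero_add n)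
    (diff_mem_almostCoboundaries (by rwa [zero_sub])) hφ

end Composition

/-! ### Coactions of a resolution of the unit and almost chain maps -/

section Coactions

variable {C : Type u} [Category.{v} C] [Abelian C] [MonoidalCategory C] [MonoidalPreadditive C]
  {T X X' Y Y' : ChainComplex C ℕ}

variable {R : C} {P : ProjectiveResolution R} (hP : TensorExact P) (e : R ≅ 𝟙_ C)

include hP

/-- A coaction `X ⟶ X ⊗ P` which is strictly counital. -/
lemma TensorExact.exists_coaction_right (X : ChainComplex C ℕ) [∀ p, Projective (X.X p)] :
    ∃ δ : DFam X X P.complex, δ.HasDegree 0 ∧ ddiff 0 δ = 0 ∧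
      ∀ i, δ i i 0 ≫ augRight P e (X.X i) = 𝟙 (X.X i) := by
  obtain ⟨δ, h1, h2, h3⟩ := hP.exists_ddiff_eq_right e (n := 0) (N := 0) (T := X) (X := X) (u := 0)
    (y := homFam (𝟙 X)) (fun _ _ _ _ => rfl) (homFam_mem_almostCocycles _).1
    (fun p i j _ => by simp [ddiff_apply]) (fun p i _ => by simp [diff_homFam])
  refine ⟨δ, h1, ?_, fun i => ?_⟩
  · funext p i j
    exact h3 p i j (Nat.zero_le _)
  · rw [h2, homFam_self, HomologicalComplex.id_f]

/-- A coaction `X ⟶ P ⊗ X` which is strictly counital. -/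
lemma TensorExact.exists_coaction_left (X : ChainComplex C ℕ) [∀ p, Projective (X.X p)] :
    ∃ δ : DFam X P.complex X, δ.HasDegree 0 ∧ ddiff 0 δ = 0 ∧
      ∀ i, δ i 0 i ≫ augLeft P e (X.X i) = 𝟙 (X.X i) := by
  obtain ⟨δ, h1, h2, h3⟩ := hP.exists_ddiff_eq_left e (n := 0) (N := 0) (T := X) (X := X) (u := 0)
    (y := homFam (𝟙 X)) (fun _ _ _ _ => rfl) (homFam_mem_almostCocycles _).1
    (fun p i j _ => by simp [ddiff_apply]) (fun p i _ => by simp [diff_homFam])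
  refine ⟨δ, h1, ?_, fun i => ?_⟩
  · funext p i j
    exact h3 p i j (Nat.zero_le _)
  · rw [h2, homFam_self, HomologicalComplex.id_f]

/-- Coactions by `P` from the right commute with almost chain maps `φ`, up to a homotopy and up to a
family with values in a part `X'_{<K} ⊗ P`. -/
lemma TensorExact.exists_actLeft_sub_preComp [∀ p, Projective (X.X p)] {m : ℤ}
    {φ : Fam X X'} (hφ : φ ∈ almostCocycles X X' m)
    {Δ : DFam X X P.complex} (hΔ : Δ.HasDegree 0) (hdΔ : ddiff 0 Δ = 0)
    {κ : Fam X X} (hκ : κ ∈ cochains X X (-1))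
    (hΔκ : ∀ p i, Δ p i 0 ≫ augRight P e (X.X i) = homFam (𝟙 X) p i + diff X X (-1) κ p i)
    {δ : DFam X' X' P.complex} (hdδ : ddiff 0 δ = 0)
    (hδ : ∀ i, δ i i 0 ≫ augRight P e (X'.X i) = 𝟙 (X'.X i)) :
    ∃ h : DFam X X' P.complex, h.HasDegree (m - 1) ∧ ∃ K, ∀ p i j, K ≤ i →
      (actLeft m φ Δ - preComp φ δ - ddiff (m - 1) h) p i j = 0 := by
  obtain ⟨n, rfl⟩ : ∃ n, m = n + 1 := ⟨m - 1, by ring⟩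
  rw [add_sub_cancel_right]
  obtain ⟨hφ0, K, hK⟩ := hφ
  have hd : ∀ p i j, K ≤ i →
      ddiff (n + 1 + 0) (actLeft (n + 1) φ Δ - preComp φ δ) p i j = 0 := by
    intro p i j hi
    rw [ddiff_sub, ddiff_actLeft rfl hφ0, hdΔ, add_zero (n + 1), ddiff_preComp φ hdδ]
    change actLeft (n + 1 + 1) (diff X X' (n + 1) φ) Δ p i j +
      (n + 1).negOnePow • actLeft (n + 1) φ 0 p i j - preComp (diff X X' (n + 1) φ) δ p i j = 0
    rw [actLeft, hK _ i hi, actLeft, preComp, hK _ (i + j) (by lia)]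
    simp
  rw [add_zero] at hd
  have hy : ∀ p i, K ≤ i → (actLeft (n + 1) φ Δ - preComp φ δ) p i 0 ≫ augRight P e (X'.X i) =
      diff X X' n ((n + 1).negOnePow • comp (n + 1) φ κ) p i := by
    intro p i hi
    have e2 : comp (n + 1 + 1) (diff X X' (n + 1) φ) κ p i = 0 := by
      rw [comp_apply, hK _ i hi, comp_zero]
    have e3 : comp (n + 1) φ (homFam (𝟙 X)) p i = φ p i := by rw [comp_homFam_id hφ0]
    rw [map_units_smul, diff_comp (m := -1) (by ring) hφ0, smul_add, smul_smul, Int.units_mul_self, one_smul]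
    change (actLeft (n + 1) φ Δ p i 0 - φ p i ≫ δ i i 0) ≫ _ =
      (n + 1).negOnePow • comp (n + 1 + 1) (diff X X' (n + 1) φ) κ p i +
        comp (n + 1) φ (diff X X (-1) κ) p i
    rw [e2, smul_zero, zero_add, Preadditive.sub_comp, Category.assoc, hδ, Category.comp_id,
      actLeft, Category.assoc, augRight_naturality, ← Category.assoc, hΔκ, Preadditive.add_comp,
      ← comp_apply, ← comp_apply, e3, add_sub_cancel_left]
  obtain ⟨h, h1, -, h3⟩ := hP.exists_ddiff_eq_right e
    (sub_hasDegree (actLeft_hasDegree (add_zero _) hφ0 hΔ) (preComp_hasDegree hφ0 δ))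
    (units_smul_mem _ _ (comp_mem_cochains (by ring) hφ0 hκ)) hd hy
  refine ⟨h, h1, K, fun p i j hi => ?_⟩
  change (actLeft (n + 1) φ Δ - preComp φ δ) p i j - ddiff n h p i j = 0
  rw [h3 p i j hi, sub_self]

/-- Coactions by `P` from the left commute with almost chain maps `ψ`, up to a homotopy and up to a
family with values in a part `P ⊗ X'_{<K}`. -/
lemma TensorExact.exists_actRight_sub_preComp [∀ p, Projective (X.X p)] {m : ℤ}
    {ψ : Fam X X'} (hψ : ψ ∈ almostCocycles X X' m)
    {Δ : DFam X P.complex X} (hΔ : Δ.HasDegree 0) (hdΔ : ddiff 0 Δ = 0)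
    {κ : Fam X X} (hκ : κ ∈ cochains X X (-1))
    (hΔκ : ∀ p i, Δ p 0 i ≫ augLeft P e (X.X i) = homFam (𝟙 X) p i + diff X X (-1) κ p i)
    {δ : DFam X' P.complex X'} (hdδ : ddiff 0 δ = 0)
    (hδ : ∀ i, δ i 0 i ≫ augLeft P e (X'.X i) = 𝟙 (X'.X i)) :
    ∃ h : DFam X P.complex X', h.HasDegree (m - 1) ∧ ∃ K, ∀ p i j, K ≤ j →
      (actRight m ψ Δ - preComp ψ δ - ddiff (m - 1) h) p i j = 0 := by
  obtain ⟨n, rfl⟩ : ∃ n, m = n + 1 := ⟨m - 1, by ring⟩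
  rw [add_sub_cancel_right]
  obtain ⟨hψ0, K, hK⟩ := hψ
  have hd : ∀ p i j, K ≤ j →
      ddiff (n + 1 + 0) (actRight (n + 1) ψ Δ - preComp ψ δ) p i j = 0 := by
    intro p i j hj
    rw [ddiff_sub, ddiff_actRight rfl hψ0, hdΔ, add_zero (n + 1), ddiff_preComp ψ hdδ]
    change actRight (n + 1 + 1) (diff X X' (n + 1) ψ) Δ p i j +
      (n + 1).negOnePow • actRight (n + 1) ψ 0 p i j - preComp (diff X X' (n + 1) ψ) δ p i j = 0
    rw [actRight, hK _ j hj, actRight, preComp, hK _ (i + j) (by lia)]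
    simp
  rw [add_zero] at hd
  have hy : ∀ p j, K ≤ j → (actRight (n + 1) ψ Δ - preComp ψ δ) p 0 j ≫ augLeft P e (X'.X j) =
      diff X X' n ((n + 1).negOnePow • comp (n + 1) ψ κ) p j := by
    intro p j hj
    have e2 : comp (n + 1 + 1) (diff X X' (n + 1) ψ) κ p j = 0 := by
      rw [comp_apply, hK _ j hj, comp_zero]
    have e3 : comp (n + 1) ψ (homFam (𝟙 X)) p j = ψ p j := by rw [comp_homFam_id hψ0]
    have e4 : preComp ψ δ p 0 j = ψ p j ≫ δ j 0 j := by rw [preComp, zero_add]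
    rw [map_units_smul, diff_comp (m := -1) (by ring) hψ0, smul_add, smul_smul, Int.units_mul_self, one_smul]
    change (actRight (n + 1) ψ Δ p 0 j - preComp ψ δ p 0 j) ≫ _ =
      (n + 1).negOnePow • comp (n + 1 + 1) (diff X X' (n + 1) ψ) κ p j +
        comp (n + 1) ψ (diff X X (-1) κ) p j
    rw [e2, e4, smul_zero, zero_add, Preadditive.sub_comp, Category.assoc, hδ, Category.comp_id,
      actRight, Nat.cast_zero, zero_mul, Int.negOnePow_zero, one_smul, Category.assoc,
      augLeft_naturality, ← Category.assoc, hΔκ, Preadditive.add_comp,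
      ← comp_apply, ← comp_apply, e3, add_sub_cancel_left]
  obtain ⟨h, h1, -, h3⟩ := hP.exists_ddiff_eq_left e
    (sub_hasDegree (actRight_hasDegree (add_zero _) hψ0 hΔ) (preComp_hasDegree hψ0 δ))
    (units_smul_mem _ _ (comp_mem_cochains (by ring) hψ0 hκ)) hd hy
  refine ⟨h, h1, K, fun p i j hj => ?_⟩
  change (actRight (n + 1) ψ Δ - preComp ψ δ) p i j - ddiff n h p i j = 0
  rw [h3 p i j hj, sub_self]

end Coactions

/-! ### Components of maps to a tensor product of complexes -/

section TensorComponents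

variable {C : Type u} [Category.{v} C] [Abelian C] [MonoidalCategory C]
  {A D T : ChainComplex C ℕ}

/-- The morphism `A_i ⊗ D_j ⟶ A_{i'} ⊗ D_{j'}` which is the identity if the indices agree and zero
otherwise. -/
def summandHom (A D : ChainComplex C ℕ) (i' j' i j : ℕ) : A.X i ⊗ D.X j ⟶ A.X i' ⊗ D.X j' :=
  if h : i = i' ∧ j = j' then eqToHom (by rw [h.1, h.2]) else 0

lemma summandHom_self (i j : ℕ) : summandHom A D i j i j = 𝟙 _ := by
  simp [summandHom]

lemma summandHom_of_ne {i' j' i j : ℕ} (h : ¬(i = i' ∧ j = j')) :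
    summandHom A D i' j' i j = 0 := dif_neg h

variable [MonoidalPreadditive C]

/-- The projection of the degree `s` term of `A ⊗ D` to the summand `A_i ⊗ D_j`; it is zero if
`i + j ≠ s`. -/
noncomputable def tensorProj (A D : ChainComplex C ℕ) (i j s : ℕ) :
    (tensorComplex A D).X s ⟶ A.X i ⊗ D.X j :=
  tensorDesc (summandHom A D i j) s

lemma ι_tensorProj (i j i' j' s : ℕ) (h : i' + j' = s) :
    HomologicalComplex.ιTensorObj A D i' j' s h ≫ tensorProj A D i j s =
      summandHom A D i j i' j' :=
  ι_tensorDesc _ _ _ _ _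

lemma tensorProj_of_ne {i j s : ℕ} (h : i + j ≠ s) : tensorProj A D i j s = 0 :=
  tensor_hom_ext fun i' j' h' => by
    rw [ι_tensorProj, summandHom_of_ne (by lia), comp_zero]

/-- A morphism out of `A ⊗ D` which is nonzero on one summand only factors through the projection
to it. -/
lemma tensorDesc_eq {Y : C} (f : ∀ i j : ℕ, A.X i ⊗ D.X j ⟶ Y) (i j s : ℕ)
    (hf : ∀ i' j', i' + j' = s → ¬(i' = i ∧ j' = j) → f i' j' = 0) :
    tensorDesc f s = tensorProj A D i j s ≫ f i j := by
  refine tensor_hom_ext fun i' j' h => ?_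
  rw [ι_tensorDesc, ← Category.assoc, ι_tensorProj]
  by_cases h' : i' = i ∧ j' = j
  · obtain ⟨rfl, rfl⟩ := h'
    rw [summandHom_self, Category.id_comp]
  · rw [summandHom_of_ne h', zero_comp, hf i' j' h h']

lemma d_tensorProj (i j s : ℕ) :
    (tensorComplex A D).d s (s - 1) ≫ tensorProj A D i j (s - 1) =
      tensorProj A D (i + 1) j s ≫ A.d (i + 1) i ▷ D.X j +
        (i : ℤ).negOnePow • (tensorProj A D i (j + 1) s ≫ A.X i ◁ D.d (j + 1) j) := by
  rw [tensorProj, d_tensorDesc]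
  refine tensor_hom_ext fun i' j' h => ?_
  rw [ι_tensorDesc, Preadditive.comp_add, Linear.comp_units_smul, ← Category.assoc,
    ← Category.assoc, ι_tensorProj, ι_tensorProj]
  congr 1
  · by_cases h' : i' = i + 1 ∧ j' = j
    · obtain ⟨rfl, rfl⟩ := h'
      rw [summandHom_self, Nat.add_sub_cancel, summandHom_self, Category.id_comp, Category.comp_id]
    · rw [summandHom_of_ne h', zero_comp]
      rcases i' with _ | i'
      · rw [d_zero_zero, MonoidalPreadditive.zero_whiskerRight, zero_comp]
      · rw [Nat.add_sub_cancel, summandHom_of_ne (by lia), comp_zero]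
  · by_cases h' : i' = i ∧ j' = j + 1
    · obtain ⟨rfl, rfl⟩ := h'
      rw [summandHom_self, Nat.add_sub_cancel, summandHom_self, Category.id_comp, Category.comp_id]
    · rw [summandHom_of_ne h', zero_comp, smul_zero]
      rcases j' with _ | j'
      · rw [d_zero_zero, MonoidalPreadditive.whiskerLeft_zero, zero_comp, smul_zero]
      · rw [Nat.add_sub_cancel, summandHom_of_ne (by lia), comp_zero, smul_zero]

lemma sum_tensorProj_ι (s : ℕ) :
    ∑ x : Finset.HasAntidiagonal.antidiagonal s, tensorProj A D x.1.1 x.1.2 s ≫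
      HomologicalComplex.ιTensorObj A D x.1.1 x.1.2 s (Finset.HasAntidiagonal.mem_antidiagonal.1 x.2) =
        𝟙 ((tensorComplex A D).X s) := by
  refine tensor_hom_ext fun i j h => ?_
  rw [Preadditive.comp_sum, Category.comp_id,
    Finset.sum_eq_single ⟨(i, j), Finset.HasAntidiagonal.mem_antidiagonal.2 h⟩]
  · rw [← Category.assoc, ι_tensorProj, summandHom_self, Category.id_comp]
  · rintro ⟨⟨i', j'⟩, hx⟩ - hne
    rw [← Category.assoc, ι_tensorProj, summandHom_of_ne, zero_comp]
    rintro ⟨rfl, rfl⟩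
    exact hne rfl
  · exact fun hn => (hn (Finset.mem_univ _)).elim

lemma tensorProj_hom_ext {Y : C} {s : ℕ} {f g : Y ⟶ (tensorComplex A D).X s}
    (h : ∀ i j, i + j = s → f ≫ tensorProj A D i j s = g ≫ tensorProj A D i j s) : f = g := by
  rw [← Category.comp_id f, ← Category.comp_id g, ← sum_tensorProj_ι, Preadditive.comp_sum,
    Preadditive.comp_sum]
  refine Finset.sum_congr rfl fun x _ => ?_
  rw [← Category.assoc, ← Category.assoc, h _ _ (Finset.HasAntidiagonal.mem_antidiagonal.1 x.2)]

/-- The components of a chain map to `A ⊗ D`. -/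
noncomputable def components (Δ : T ⟶ tensorComplex A D) : DFam T A D := fun p i j =>
  Δ.f p ≫ tensorProj A D i j p

lemma components_hasDegree (Δ : T ⟶ tensorComplex A D) : (components Δ).HasDegree 0 := by
  intro p i j hp
  rw [components, tensorProj_of_ne (by lia), comp_zero]

lemma ddiff_components (Δ : T ⟶ tensorComplex A D) : ddiff 0 (components Δ) = 0 := by
  funext p i j
  have h := d_tensorProj (A := A) (D := D) i j p
  have h' := congrArg (Δ.f p ≫ ·) h
  simp only [Preadditive.comp_add, Linear.comp_units_smul] at h'
  rw [← Category.assoc, Δ.comm, Category.assoc] at h'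
  rw [ddiff_apply, Int.negOnePow_zero, one_smul]
  simp only [components, Category.assoc]
  rw [h', sub_self]
  rfl

/-- The chain map to `A ⊗ D` with given components. -/
lemma exists_components_eq {δ : DFam T A D} (h0 : δ.HasDegree 0) (hd : ddiff 0 δ = 0) :
    ∃ Δ : T ⟶ tensorComplex A D, components Δ = δ := by
  let f : ∀ p, T.X p ⟶ (tensorComplex A D).X p := fun p =>
    ∑ x : Finset.HasAntidiagonal.antidiagonal p, δ p x.1.1 x.1.2 ≫
      HomologicalComplex.ιTensorObj A D x.1.1 x.1.2 p (Finset.HasAntidiagonal.mem_antidiagonal.1 x.2)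
  have hf : ∀ p i j, f p ≫ tensorProj A D i j p = δ p i j := by
    intro p i j
    by_cases h : i + j = p
    · rw [Preadditive.sum_comp, Finset.sum_eq_single ⟨(i, j), Finset.HasAntidiagonal.mem_antidiagonal.2 h⟩]
      · rw [Category.assoc, ι_tensorProj, summandHom_self, Category.comp_id]
      · rintro ⟨⟨i', j'⟩, hx⟩ - hne
        rw [Category.assoc, ι_tensorProj, summandHom_of_ne, comp_zero]
        rintro ⟨rfl, rfl⟩
        exact hne rfl
      · exact fun hn => (hn (Finset.mem_univ _)).elim
    · rw [tensorProj_of_ne h, comp_zero, h0 p i j (by lia)]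
  refine ⟨{ f := f, comm' := ?_ }, ?_⟩
  · rintro _ p rfl
    refine tensorProj_hom_ext fun i j h => ?_
    have h1 := congrFun (congrFun (congrFun hd (p + 1)) i) j
    rw [ddiff_apply, Int.negOnePow_zero, one_smul] at h1
    have h2 := d_tensorProj (A := A) (D := D) i j (p + 1)
    rw [Nat.add_sub_cancel] at h1 h2
    rw [Category.assoc, Category.assoc, h2, Preadditive.comp_add, Linear.comp_units_smul,
      ← Category.assoc, ← Category.assoc, hf, hf, hf]
    exact sub_eq_zero.1 h1
  · funext p i j
    exact hf p i j

variable {M N : C} (o : ℕ → Bool) (P : ProjectiveResolution M) (Q : ProjectiveResolution N)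

/-- The external product pulled back along `Δ`, in terms of the components of `Δ`. -/
lemma comp_extFam_homFam {m n l : ℤ} (hl : m + n = l) {φ : Fam A P.complex} {ψ : Fam D Q.complex}
    (hφ : φ ∈ cochains A P.complex m) (hψ : ψ ∈ cochains D Q.complex n)
    (Δ : T ⟶ tensorComplex A D) :
    comp l (extFam o P Q n φ ψ) (homFam Δ) =
      pathFam o P Q (actLeft m φ (actRight n ψ (components Δ))) := by
  funext p k
  by_cases hp : (p : ℤ) = k + l
  · have e : ((k : ℤ) + l).toNat = p := by lia
    have h1 : tensorDesc (extTerm o P Q n φ ψ k) p =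
        tensorProj A D ((pCount o k : ℤ) + m).toNat ((dCount o k : ℤ) + n).toNat p ≫
          extTerm o P Q n φ ψ k _ _ := by
      refine tensorDesc_eq _ _ _ _ fun i' j' h h' => ?_
      rw [extTerm]
      by_cases hi : (i' : ℤ) = pCount o k + m
      · rw [hψ j' _ (by lia), MonoidalPreadditive.tensor_zero, zero_comp, smul_zero]
      · rw [hφ i' _ hi, MonoidalPreadditive.zero_tensor, zero_comp, smul_zero]
    have h2 : comp l (extFam o P Q n φ ψ) (homFam Δ) p k =
        Δ.f p ≫ tensorDesc (extTerm o P Q n φ ψ k) p := by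
      rw [comp_apply, e, homFam_self]
      rfl
    have h3 : Δ.f p ≫ tensorDesc (extTerm o P Q n φ ψ k) p =
        actLeft m φ (actRight n ψ (components Δ)) p (pCount o k) (dCount o k) ≫
          pathQuot o P Q k := by
      rw [h1, extTerm, actLeft, actRight, MonoidalCategory.tensorHom_def']
      simp only [components, Category.assoc, Linear.comp_units_smul, Linear.units_smul_comp]
    exact h2.trans h3
  · rw [comp_mem_cochains (add_zero l) (extFam_mem_cochains o P Q hl hφ hψ)
      (homFam_mem_almostCocycles Δ).1 p k hp]
    exact (pathFam_mem_cochains o P Q (actLeft_hasDegree hl hφ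
      (actRight_hasDegree (add_zero n) hψ (components_hasDegree Δ))) p k hp).symm

end TensorComponents

/-! ### Diagonals and lifts -/

section CupProducts

variable {C : Type u} [Category.{v} C] [Abelian C] [MonoidalCategory C] [MonoidalPreadditive C]
  {R : C} {P : ProjectiveResolution R} {e : R ≅ 𝟙_ C}

variable (e) in
/-- The families of degree `0` that are chain maps `P ⟶ P ⊗ P` lifting the canonical isomorphism of
`R ≅ 𝟙_` with `R ⊗ R`. -/
structure IsDiagonal (D : DFam P.complex P.complex P.complex) : Prop where
  hasDegree : D.HasDegree 0
  ddiff_eq_zero : ddiff 0 D = 0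
  comp_aug : D 0 0 0 ≫ augRight P e (P.complex.X 0) ≫ unitAug P e = unitAug P e

/-- The family `(id ⊗ ε) ∘ D` is the identity up to homotopy. -/
lemma IsDiagonal.exists_homotopy_right {D : DFam P.complex P.complex P.complex}
    (hD : IsDiagonal e D) : ∃ κ ∈ cochains P.complex P.complex (-1), ∀ p i,
      D p i 0 ≫ augRight P e (P.complex.X i) =
        homFam (𝟙 P.complex) p i + diff _ _ (-1) κ p i := by
  obtain ⟨κ, hκ, h⟩ := exists_diff_eq_sub_id P
    (φ := fun p i => D p i 0 ≫ augRight P e (P.complex.X i))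
    (fun p i hp => (congrArg (· ≫ augRight P e (P.complex.X i))
      (hD.hasDegree p i 0 (by simpa using hp))).trans zero_comp)
    (by
      funext p i
      have h := congrArg (· ≫ augRight P e (P.complex.X i))
        (congrFun (congrFun (congrFun hD.ddiff_eq_zero p) i) 0)
      simp only [ddiff_apply, Preadditive.sub_comp, Preadditive.add_comp, Category.assoc,
        Linear.units_smul_comp, augRight_naturality] at h
      erw [whiskerLeft_d_augRight] at h
      rw [comp_zero, smul_zero, add_zero] at h
      rw [diff_apply, Category.assoc]
      exact h.trans zero_comp)
    (by
      rw [← cancel_mono e.hom, Category.assoc, Category.assoc]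
      exact hD.comp_aug)
  exact ⟨κ, hκ, fun p i => by rw [h]; exact (add_sub_cancel _ _).symm⟩

/-- The family `(ε ⊗ id) ∘ D` is the identity up to homotopy. -/
lemma IsDiagonal.exists_homotopy_left {D : DFam P.complex P.complex P.complex}
    (hD : IsDiagonal e D) : ∃ κ ∈ cochains P.complex P.complex (-1), ∀ p i,
      D p 0 i ≫ augLeft P e (P.complex.X i) =
        homFam (𝟙 P.complex) p i + diff _ _ (-1) κ p i := by
  obtain ⟨κ, hκ, h⟩ := exists_diff_eq_sub_id P
    (φ := fun p i => D p 0 i ≫ augLeft P e (P.complex.X i))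
    (fun p i hp => (congrArg (· ≫ augLeft P e (P.complex.X i))
      (hD.hasDegree p 0 i (by simpa using hp))).trans zero_comp)
    (by
      funext p i
      have h := congrArg (· ≫ augLeft P e (P.complex.X i))
        (congrFun (congrFun (congrFun hD.ddiff_eq_zero p) 0) i)
      simp only [ddiff_apply, Preadditive.sub_comp, Preadditive.add_comp, Category.assoc,
        Linear.units_smul_comp, augLeft_naturality] at h
      erw [d_whiskerRight_augLeft] at h
      rw [comp_zero, zero_add, Nat.cast_zero, Int.negOnePow_zero, one_smul,
        ← Int.negOnePow_zero] at h
      rw [diff_apply, Category.assoc]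
      exact h.trans zero_comp)
    (by
      rw [← cancel_mono e.hom, Category.assoc, Category.assoc]
      change _ ≫ _ ≫ unitAug P e = unitAug P e
      rw [← augRight_unitAug]
      exact hD.comp_aug)
  exact ⟨κ, hκ, fun p i => by rw [h]; exact (add_sub_cancel _ _).symm⟩

/-- A lift of a diagonal, read through its components, is a double family of degree `0` that is
closed and compatible with the augmentations. -/
lemma isTensorLift_iff (Δ : P.complex ⟶ tensorComplex P.complex P.complex) :
    IsTensorLift P P P ((ρ_ _).inv ≫ _ ◁ e.inv) Δ ↔ IsDiagonal e (components Δ) := by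
  have h1 : tensorAug P P = tensorProj P.complex P.complex 0 0 0 ≫ (augTo P 0 ⊗ₘ augTo P 0) :=
    tensorDesc_eq (fun i j => augTo P i ⊗ₘ augTo P j) 0 0 0 (fun i j h h' => by lia)
  have h2 : (augTo P 0 ⊗ₘ augTo P 0) ≫ R ◁ e.hom ≫ (ρ_ R).hom ≫ e.hom =
      augRight P e (P.complex.X 0) ≫ unitAug P e := by
    rw [augRight, unitAug, MonoidalCategory.tensorHom_def']
    simp only [Category.assoc, MonoidalCategory.whiskerLeft_comp]
    rw [← whisker_exchange_assoc, rightUnitor_naturality_assoc]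
  have h3 : (augTo P 0 ≫ (ρ_ R).inv ≫ R ◁ e.inv) ≫ R ◁ e.hom ≫ (ρ_ R).hom ≫ e.hom =
      unitAug P e := by
    simp [unitAug]
  have h4 : IsTensorLift P P P ((ρ_ _).inv ≫ _ ◁ e.inv) Δ ↔
      components Δ 0 0 0 ≫ augRight P e (P.complex.X 0) ≫ unitAug P e = unitAug P e := by
    rw [IsTensorLift, h1, ← cancel_mono (R ◁ e.hom ≫ (ρ_ R).hom ≫ e.hom), h3, components]
    simp only [Category.assoc]
    rw [h2]
  rw [h4]
  exact ⟨fun h => ⟨components_hasDegree Δ, ddiff_components Δ, h⟩, fun h => h.comp_aug⟩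

variable {M N : C} {Q : ProjectiveResolution M} {o : ℕ → Bool}

lemma comp_pathFam_aug {T : ChainComplex C ℕ} {A : ProjectiveResolution M}
    {B : ProjectiveResolution N} {L : C} {S : ProjectiveResolution L} {g : M ⊗ N ⟶ L}
    {θ : pathComplex o A B ⟶ S.complex} (hθ : IsPathLift o A B S g θ)
    (h : DFam T A.complex B.complex) :
    comp 0 (homFam θ) (pathFam o A B h) 0 0 ≫ augTo S 0 =
      h 0 0 0 ≫ (augTo A 0 ⊗ₘ augTo B 0) ≫ g := by
  have h1 : comp 0 (homFam θ) (pathFam o A B h) 0 0 =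
      (h 0 0 0 ≫ pathQuot o A B 0) ≫ θ.f 0 := by
    rw [comp_apply]
    exact congrArg (_ ≫ ·) (homFam_self θ 0)
  have h2 : pathQuot o A B 0 ≫ pathπ o A B 0 = (augTo A 0 ⊗ₘ augTo B 0) :=
    stepQuot_π A B _ _ _
  have h3 : pathQuot o A B 0 ≫ θ.f 0 ≫ augTo S 0 = (augTo A 0 ⊗ₘ augTo B 0) ≫ g := by
    rw [← h2]
    exact (congrArg (pathQuot o A B 0 ≫ ·) hθ).trans (Category.assoc _ _ _).symm
  have h4 : ∀ {U V W Z : C} (a : T.X 0 ⟶ U) (b : U ⟶ V) (c : V ⟶ W) (d : W ⟶ Z) (s : U ⟶ Z),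
      b ≫ c ≫ d = s → ((a ≫ b) ≫ c) ≫ d = a ≫ s := by
    rintro U V W Z a b c d s rfl
    simp only [Category.assoc]
  rw [h1]
  exact h4 _ (pathQuot o A B 0) _ _ _ h3

/-- Composing a strict coaction `Q ⟶ Q ⊗ P` with a lift `θ` gives the identity up to homotopy. -/
lemma exists_homotopy_pathLift_right {δ : DFam Q.complex Q.complex P.complex} (h0 : δ.HasDegree 0)
    (hd : ddiff 0 δ = 0) (hδ : ∀ i, δ i i 0 ≫ augRight P e (Q.complex.X i) = 𝟙 _)
    {θ : pathComplex o Q P ⟶ Q.complex}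
    (hθ : IsPathLift o Q P Q ((M ◁ e.hom) ≫ (ρ_ M).hom) θ) :
    ∃ κ ∈ cochains Q.complex Q.complex (-1), diff _ _ (-1) κ =
      comp 0 (homFam θ) (pathFam o Q P δ) - homFam (𝟙 Q.complex) := by
  refine exists_diff_eq_sub_id Q (comp_mem_cochains (add_zero 0) (homFam_mem_almostCocycles θ).1
    (pathFam_mem_cochains o Q P h0)) ?_ ?_
  · rw [diff_comp (add_zero 0) (homFam_mem_almostCocycles θ).1, diff_homFam, diff_pathFam, hd,
      map_zero, map_zero, map_zero, AddMonoidHom.zero_apply, smul_zero, add_zero]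
  · have h : (augTo Q 0 ⊗ₘ augTo P 0) ≫ (M ◁ e.hom) ≫ (ρ_ M).hom =
        augRight P e (Q.complex.X 0) ≫ augTo Q 0 := by
      rw [MonoidalCategory.tensorHom_def', Category.assoc, ← whisker_exchange_assoc,
        rightUnitor_naturality, augRight, unitAug, MonoidalCategory.whiskerLeft_comp]
      simp only [Category.assoc]
    rw [comp_pathFam_aug hθ, h, ← Category.assoc, hδ, Category.id_comp]

/-- Composing a strict coaction `Q ⟶ P ⊗ Q` with a lift `θ` gives the identity up to homotopy. -/
lemma exists_homotopy_pathLift_left {δ : DFam Q.complex P.complex Q.complex} (h0 : δ.HasDegree 0)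
    (hd : ddiff 0 δ = 0) (hδ : ∀ i, δ i 0 i ≫ augLeft P e (Q.complex.X i) = 𝟙 _)
    {θ : pathComplex o P Q ⟶ Q.complex}
    (hθ : IsPathLift o P Q Q ((e.hom ▷ M) ≫ (λ_ M).hom) θ) :
    ∃ κ ∈ cochains Q.complex Q.complex (-1), diff _ _ (-1) κ =
      comp 0 (homFam θ) (pathFam o P Q δ) - homFam (𝟙 Q.complex) := by
  refine exists_diff_eq_sub_id Q (comp_mem_cochains (add_zero 0) (homFam_mem_almostCocycles θ).1
    (pathFam_mem_cochains o P Q h0)) ?_ ?_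
  · rw [diff_comp (add_zero 0) (homFam_mem_almostCocycles θ).1, diff_homFam, diff_pathFam, hd,
      map_zero, map_zero, map_zero, AddMonoidHom.zero_apply, smul_zero, add_zero]
  · have h : (augTo P 0 ⊗ₘ augTo Q 0) ≫ (e.hom ▷ M) ≫ (λ_ M).hom =
        augLeft P e (Q.complex.X 0) ≫ augTo Q 0 := by
      rw [MonoidalCategory.tensorHom_def, Category.assoc, whisker_exchange_assoc,
        leftUnitor_naturality, augLeft, unitAug, comp_whiskerRight]
      simp only [Category.assoc]
    rw [comp_pathFam_aug hθ, h, ← Category.assoc, hδ, Category.id_comp]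

end CupProducts

/-! ### Cup products on representatives -/

section Units

variable {C : Type u} [Category.{v} C] [Abelian C] [MonoidalCategory C] [MonoidalPreadditive C]
  {M N : C} {A : ProjectiveResolution M} {B : ProjectiveResolution N} {o : ℕ → Bool}
  {S T X : ChainComplex C ℕ}

instance projective_complex_X (A : ProjectiveResolution M) (k : ℕ) :
    Projective (A.complex.X k) := A.projective k

lemma pathFam_mem_sup_left (ho : IsPath o) {l : ℤ} {v h : DFam T A.complex B.complex}
    (hh : h.HasDegree (l - 1)) {K : ℕ} (hK : ∀ p i j, K ≤ i → (v - ddiff (l - 1) h) p i j = 0) :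
    pathFam o A B v ∈ (cochains T (pathComplex o A B) (l - 1)).map (diff _ _ (l - 1)) ⊔
      bounded T (pathComplex o A B) := by
  rw [← sub_add_cancel v (ddiff (l - 1) h), map_add, ← diff_pathFam]
  exact add_mem (AddSubgroup.mem_sup_right (pathFam_mem_bounded_left A B ho hK))
    (AddSubgroup.mem_sup_left ⟨_, pathFam_mem_cochains o A B hh, rfl⟩)

lemma pathFam_mem_sup_right (ho : IsPath o) {l : ℤ} {v h : DFam T A.complex B.complex}
    (hh : h.HasDegree (l - 1)) {K : ℕ} (hK : ∀ p i j, K ≤ j → (v - ddiff (l - 1) h) p i j = 0) :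
    pathFam o A B v ∈ (cochains T (pathComplex o A B) (l - 1)).map (diff _ _ (l - 1)) ⊔
      bounded T (pathComplex o A B) := by
  rw [← sub_add_cancel v (ddiff (l - 1) h), map_add, ← diff_pathFam]
  exact add_mem (AddSubgroup.mem_sup_right (pathFam_mem_bounded_right A B ho hK))
    (AddSubgroup.mem_sup_left ⟨_, pathFam_mem_cochains o A B hh, rfl⟩)

lemma pathFam_preComp (φ : Fam S T) (δ : DFam T A.complex B.complex) :
    pathFam o A B (preComp φ δ) = comp 0 (pathFam o A B δ) φ := by
  funext p k
  have h : pCount o k + dCount o k = ((k : ℤ) + 0).toNat := by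
    rw [pCount_add_dCount]; lia
  have h1 : ∀ q, pCount o k + dCount o k = q →
      preComp φ δ p (pCount o k) (dCount o k) ≫ pathQuot o A B k =
        φ p q ≫ δ q (pCount o k) (dCount o k) ≫ pathQuot o A B k := by
    rintro _ rfl
    exact Category.assoc _ _ _
  exact h1 _ h

lemma pathFam_actLeft_preComp {m : ℤ} {φ : Fam X A.complex} (hφ : φ ∈ cochains X A.complex m)
    (ψ : Fam S T) (δ : DFam T X B.complex) :
    pathFam o A B (actLeft m φ (preComp ψ δ)) = comp m (pathFam o A B (actLeft m φ δ)) ψ := by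
  funext p k
  have hk := pCount_add_dCount o k
  have h1 : ∀ q, (0 ≤ (pCount o k : ℤ) + m → ((pCount o k : ℤ) + m).toNat + dCount o k = q) →
      actLeft m φ (preComp ψ δ) p (pCount o k) (dCount o k) ≫ pathQuot o A B k =
        ψ p q ≫ actLeft m φ δ q (pCount o k) (dCount o k) ≫ pathQuot o A B k := by
    intro q hq
    simp only [actLeft, preComp, Category.assoc]
    by_cases h0 : 0 ≤ (pCount o k : ℤ) + m
    · obtain rfl := hq h0
      rfl
    · rw [hφ _ (pCount o k) (by lia)]
      simp
  exact h1 _ (fun h0 => by lia)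

variable {R : C} {P : ProjectiveResolution R} (hP : TensorExact P) {e : R ≅ 𝟙_ C} (ho : IsPath o)
  {Q : ProjectiveResolution M} {D : DFam P.complex P.complex P.complex} (hD : IsDiagonal e D)

include hP ho hD

/-- On representatives: the class of the identity is a right unit for the cup product. -/
lemma comp_pathFam_actLeft_sub_mem {θ : pathComplex o Q P ⟶ Q.complex}
    (hθ : IsPathLift o Q P Q ((M ◁ e.hom) ≫ (ρ_ M).hom) θ) {m : ℤ}
    {φ : Fam P.complex Q.complex} (hφ : φ ∈ almostCocycles P.complex Q.complex m) :
    comp 0 (homFam θ) (pathFam o Q P (actLeft m φ D)) - φ ∈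
      almostCoboundaries P.complex Q.complex m := by
  obtain ⟨κ, hκ, hDκ⟩ := hD.exists_homotopy_right
  obtain ⟨δ, hδ0, hdδ, hδ⟩ := hP.exists_coaction_right e Q.complex
  obtain ⟨h, hh, K, hK⟩ := hP.exists_actLeft_sub_preComp e hφ hD.hasDegree hD.ddiff_eq_zero hκ hDκ
    hdδ hδ
  obtain ⟨κ', hκ', hθδ⟩ := exists_homotopy_pathLift_right hδ0 hdδ hδ hθ
  have h1 : pathFam o Q P (actLeft m φ D - preComp φ δ) ∈
      almostCoboundaries P.complex (pathComplex o Q P) m :=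
    ⟨pathFam_mem_cochains o Q P (sub_hasDegree
      (actLeft_hasDegree (add_zero m) hφ.1 hD.hasDegree) (preComp_hasDegree hφ.1 δ)),
      pathFam_mem_sup_left ho hh hK⟩
  have h2 := comp_mem_almostCoboundaries_right (zero_add m) (homFam_mem_almostCocycles θ) h1
  rw [map_sub, map_sub, pathFam_preComp] at h2
  refine sub_mem_almostCoboundaries_trans h2 ?_
  rw [← comp_assoc (zero_add 0) (homFam_mem_almostCocycles θ).1]
  exact comp_sub_mem_almostCoboundaries hκ' hθδ hφ

/-- On representatives: the class of the identity is a left unit for the cup product. -/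
lemma comp_pathFam_actRight_sub_mem {θ : pathComplex o P Q ⟶ Q.complex}
    (hθ : IsPathLift o P Q Q ((e.hom ▷ M) ≫ (λ_ M).hom) θ) {m : ℤ}
    {ψ : Fam P.complex Q.complex} (hψ : ψ ∈ almostCocycles P.complex Q.complex m) :
    comp 0 (homFam θ) (pathFam o P Q (actRight m ψ D)) - ψ ∈
      almostCoboundaries P.complex Q.complex m := by
  obtain ⟨κ, hκ, hDκ⟩ := hD.exists_homotopy_left
  obtain ⟨δ, hδ0, hdδ, hδ⟩ := hP.exists_coaction_left e Q.complex
  obtain ⟨h, hh, K, hK⟩ := hP.exists_actRight_sub_preComp e hψ hD.hasDegree hD.ddiff_eq_zero hκ hDκ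
    hdδ hδ
  obtain ⟨κ', hκ', hθδ⟩ := exists_homotopy_pathLift_left hδ0 hdδ hδ hθ
  have h1 : pathFam o P Q (actRight m ψ D - preComp ψ δ) ∈
      almostCoboundaries P.complex (pathComplex o P Q) m :=
    ⟨pathFam_mem_cochains o P Q (sub_hasDegree
      (actRight_hasDegree (add_zero m) hψ.1 hD.hasDegree) (preComp_hasDegree hψ.1 δ)),
      pathFam_mem_sup_right ho hh hK⟩
  have h2 := comp_mem_almostCoboundaries_right (zero_add m) (homFam_mem_almostCocycles θ) h1
  rw [map_sub, map_sub, pathFam_preComp] at h2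
  refine sub_mem_almostCoboundaries_trans h2 ?_
  rw [← comp_assoc (zero_add 0) (homFam_mem_almostCocycles θ).1]
  exact comp_sub_mem_almostCoboundaries hκ' hθδ hψ

/-- On representatives: if the second factor has coefficients in `R`, the cup product is the
composition product. -/
lemma comp_pathFam_actLeft_actRight_sub_mem {θ : pathComplex o Q P ⟶ Q.complex}
    (hθ : IsPathLift o Q P Q ((M ◁ e.hom) ≫ (ρ_ M).hom) θ) {m n l : ℤ} (hl : m + n = l)
    {φ : Fam P.complex Q.complex} (hφ : φ ∈ almostCocycles P.complex Q.complex m)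
    {ψ : Fam P.complex P.complex} (hψ : ψ ∈ almostCocycles P.complex P.complex n) :
    comp 0 (homFam θ) (pathFam o Q P (actLeft m φ (actRight n ψ D))) - comp m φ ψ ∈
      almostCoboundaries P.complex Q.complex l := by
  obtain ⟨κ, hκ, hDκ⟩ := hD.exists_homotopy_left
  obtain ⟨δ, hδ0, hdδ, hδ⟩ := hP.exists_coaction_left e P.complex
  obtain ⟨h, hh, K, hK⟩ := hP.exists_actRight_sub_preComp e hψ hD.hasDegree hD.ddiff_eq_zero hκ hDκ
    hdδ hδ
  have hδD : IsDiagonal e δ := ⟨hδ0, hdδ, by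
    rw [augRight_unitAug, ← Category.assoc, hδ, Category.id_comp]⟩
  -- acting with `φ` on the homotopy gives a homotopy, because `dφ` is bounded
  have h1 : pathFam o Q P (actLeft m φ (actRight n ψ D - preComp ψ δ)) ∈
      almostCoboundaries P.complex (pathComplex o Q P) l := by
    refine ⟨pathFam_mem_cochains o Q P (actLeft_hasDegree hl hφ.1 (sub_hasDegree
      (actRight_hasDegree (add_zero n) hψ.1 hD.hasDegree) (preComp_hasDegree hψ.1 δ))), ?_⟩
    have e0 : actLeft m φ (actRight n ψ D - preComp ψ δ) =
        actLeft m φ (actRight n ψ D - preComp ψ δ - ddiff (n - 1) h) +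
          actLeft m φ (ddiff (n - 1) h) := by
      rw [actLeft_sub _ _ (_ - _) (ddiff _ _), sub_add_cancel]
    rw [e0, map_add]
    refine add_mem (AddSubgroup.mem_sup_right (pathFam_mem_bounded_right Q P ho (K := K) ?_)) ?_
    · intro p i j hj
      rw [actLeft, hK _ _ j hj, zero_comp]
    · obtain ⟨L, hL⟩ := hφ.2
      have e1 := ddiff_actLeft (show m + (n - 1) = l - 1 by lia) hφ.1 h
      have e2 := congrArg (pathFam o Q P) e1
      rw [map_add, map_units_smul, ← diff_pathFam] at e2
      have e3 : m.negOnePow • pathFam o Q P (actLeft m φ (ddiff (n - 1) h)) ∈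
          (cochains P.complex (pathComplex o Q P) (l - 1)).map (diff _ _ (l - 1)) ⊔
            bounded P.complex (pathComplex o Q P) := by
        rw [← sub_eq_iff_eq_add'.2 e2]
        refine AddSubgroup.sub_mem _ (AddSubgroup.mem_sup_left ⟨_, pathFam_mem_cochains o Q P
          (actLeft_hasDegree (by lia) hφ.1 hh), rfl⟩)
          (AddSubgroup.mem_sup_right (pathFam_mem_bounded_left Q P ho (K := L) ?_))
        intro p i j hi
        rw [actLeft, hL _ i hi, MonoidalPreadditive.zero_whiskerRight, comp_zero]
      have e4 := units_smul_mem _ m.negOnePow e3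
      rwa [smul_smul, Int.units_mul_self, one_smul] at e4
  have h2 := comp_mem_almostCoboundaries_right (zero_add l) (homFam_mem_almostCocycles θ) h1
  rw [actLeft_sub, map_sub, map_sub, pathFam_actLeft_preComp hφ.1] at h2
  refine sub_mem_almostCoboundaries_trans h2 ?_
  have h3 := comp_mem_almostCoboundaries_left hl
    (comp_pathFam_actLeft_sub_mem hP ho hδD hθ hφ) hψ
  rwa [map_sub, AddMonoidHom.sub_apply, comp_assoc (zero_add m) (homFam_mem_almostCocycles θ).1]
    at h3

end Units

/-! ### Existence of the lifts, units and comparison with the Yoneda product -/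

section Cup

lemma CExt.exists_mk {C : Type u} [Category.{v} C] [Preadditive C] {A B : ChainComplex C ℕ} {n : ℤ}
    (x : CExt n A B) : ∃ (φ : Fam A B) (hφ : φ ∈ almostCocycles A B n), CExt.mk φ hφ = x := by
  obtain ⟨⟨φ, hφ⟩, rfl⟩ := QuotientAddGroup.mk_surjective x
  exact ⟨φ, hφ, rfl⟩

variable {C : Type u} [Category.{v} C] [Abelian C] [MonoidalCategory C] [MonoidalPreadditive C]
  {M R : C} {P : ProjectiveResolution R} {e : R ≅ 𝟙_ C} {o : ℕ → Bool}
  {Q : ProjectiveResolution M}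

/-- The cup product of the classes of two almost chain maps, in terms of the components of `Δ`. -/
lemma cup_mk_mk {N : C} {A : ProjectiveResolution M} {B : ProjectiveResolution N} (ho : IsPath o)
    {S T : ChainComplex C ℕ}
    (Δ : S ⟶ tensorComplex S S) (θ : pathComplex o A B ⟶ T) {m n l : ℤ} (hl : m + n = l)
    {φ : Fam S A.complex} (hφ : φ ∈ almostCocycles S A.complex m)
    {ψ : Fam S B.complex} (hψ : ψ ∈ almostCocycles S B.complex n) {χ : Fam S T}
    (hχ : χ ∈ almostCocycles S T l)
    (h : comp 0 (homFam θ) (pathFam o A B (actLeft m φ (actRight n ψ (components Δ)))) - χ ∈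
      almostCoboundaries S T l) :
    cup ho A B Δ θ hl (CExt.mk φ hφ) (CExt.mk ψ hψ) = CExt.mk χ hχ := by
  rw [← comp_extFam_homFam o A B hl hφ.1 hψ.1] at h
  exact CExt.mk_eq_mk (comp_mem_almostCocycles (zero_add l) (homFam_mem_almostCocycles θ)
    (comp_mem_almostCocycles (add_zero l) (extFam_mem_almostCocycles A B ho hl hφ hψ)
      (homFam_mem_almostCocycles Δ))) hχ h

lemma exists_isTensorLift (hP : TensorExact P) (e : R ≅ 𝟙_ C) :
    ∃ Δ : P.complex ⟶ tensorComplex P.complex P.complex,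
      IsTensorLift P P P ((ρ_ _).inv ≫ _ ◁ e.inv) Δ := by
  obtain ⟨δ, hδ0, hdδ, hδ⟩ := hP.exists_coaction_right e P.complex
  obtain ⟨Δ, rfl⟩ := exists_components_eq hδ0 hdδ
  exact ⟨Δ, (isTensorLift_iff Δ).2
    ⟨hδ0, hdδ, by rw [← Category.assoc, hδ, Category.id_comp]⟩⟩

lemma FlatSyzygies.projective_pathComplex {N : C} {A : ProjectiveResolution M}
    {B : ProjectiveResolution N} (hA : FlatSyzygies A) (hB : FlatSyzygies B) (k : ℕ) :
    Projective ((pathComplex o A B).X k) := by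
  have h : ∀ b p d, Projective (stepX A B b p d) := by
    rintro (_ | _) p d
    · exact (hA.tensorLeft_preservesProjectives p).projective_obj inferInstance
    · exact (hB.tensorRight_preservesProjectives d).projective_obj inferInstance
  exact h _ _ _

lemma exists_isPathLift {N L : C} {A : ProjectiveResolution M}
    {B : ProjectiveResolution N} (hA : FlatSyzygies A) (hB : FlatSyzygies B)
    (S : ProjectiveResolution L) (g : M ⊗ N ⟶ L) :
    ∃ θ : pathComplex o A B ⟶ S.complex, IsPathLift o A B S g θ := by
  have := hA.projective_pathComplex hB (o := o)
  refine exists_chainMap (pathComplex o A B) S (pathAug o A B ≫ g) ?_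
  have h : (pathπ o A B 1 ≫ pathι o A B 0) ≫ pathπ o A B 0 ≫ g = 0 := by
    have h' : ∀ {U V W : C} (a : U ⟶ V) (b : V ⟶ W) (c : W ⟶ M ⊗ N), b ≫ c = 0 →
        (a ≫ b) ≫ c ≫ g = 0 := by
      intro U V W a b c hbc
      rw [Category.assoc, reassoc_of% hbc, zero_comp, comp_zero]
    exact h' _ _ _ (pathι_π o A B 0)
  exact (congrArg (· ≫ pathπ o A B 0 ≫ g) (pathComplex_d o A B 0)).trans h

variable (hP : TensorExact P) (ho : IsPath o) {Δ : P.complex ⟶ tensorComplex P.complex P.complex}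
  (hΔ : IsTensorLift P P P ((ρ_ _).inv ≫ _ ◁ e.inv) Δ)

include hP hΔ

lemma cup_unitClass {θ : pathComplex o Q P ⟶ Q.complex}
    (hθ : IsPathLift o Q P Q ((M ◁ e.hom) ≫ (ρ_ M).hom) θ) (n : ℤ)
    (x : CExt n P.complex Q.complex) :
    cup ho Q P Δ θ (add_zero n) x (unitClass P) = x := by
  obtain ⟨φ, hφ, rfl⟩ := CExt.exists_mk x
  refine cup_mk_mk ho Δ θ (add_zero n) hφ (homFam_mem_almostCocycles _) hφ ?_
  rw [actRight_id]
  exact comp_pathFam_actLeft_sub_mem hP ho ((isTensorLift_iff Δ).1 hΔ) hθ hφ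

lemma unitClass_cup {θ : pathComplex o P Q ⟶ Q.complex}
    (hθ : IsPathLift o P Q Q ((e.hom ▷ M) ≫ (λ_ M).hom) θ) (n : ℤ)
    (x : CExt n P.complex Q.complex) :
    cup ho P Q Δ θ (zero_add n) (unitClass P) x = x := by
  obtain ⟨ψ, hψ, rfl⟩ := CExt.exists_mk x
  refine cup_mk_mk ho Δ θ (zero_add n) (homFam_mem_almostCocycles _) hψ hψ ?_
  rw [actLeft_id]
  exact comp_pathFam_actRight_sub_mem hP ho ((isTensorLift_iff Δ).1 hΔ) hθ hψ

/-- The cup product of `x` with a class `y` with coefficients in `R` is the Yoneda product. -/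
lemma cup_eq_yoneda {θ : pathComplex o Q P ⟶ Q.complex}
    (hθ : IsPathLift o Q P Q ((M ◁ e.hom) ≫ (ρ_ M).hom) θ) {m n l : ℤ} (hl : m + n = l)  :
    cup ho Q P Δ θ hl = yoneda (A := P.complex) (B := P.complex) (D := Q.complex) hl := by
  refine AddMonoidHom.ext fun x => AddMonoidHom.ext fun y => ?_
  obtain ⟨φ, hφ, rfl⟩ := CExt.exists_mk x
  obtain ⟨ψ, hψ, rfl⟩ := CExt.exists_mk y
  exact cup_mk_mk ho Δ θ hl hφ hψ (comp_mem_almostCocycles hl hφ hψ)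
    (comp_pathFam_actLeft_actRight_sub_mem hP ho ((isTensorLift_iff Δ).1 hΔ) hθ hl hφ hψ)

end Cup

/-! ### Graded rings -/

section GradedRing

open scoped DirectSum

/-- A graded ring from graded biadditive products which are unital and associative. -/
lemma isGradedRing_of_assoc {X : ℤ → Type v} [∀ n, AddCommGroup (X n)] (one : X 0)
    (mul : ∀ i j : ℤ, X i →+ X j →+ X (i + j))
    (one_mul : ∀ i (x : X i), GradedMonoid.mk (0 + i) (mul 0 i one x) = GradedMonoid.mk i x)
    (mul_one : ∀ i (x : X i), GradedMonoid.mk (i + 0) (mul i 0 x one) = GradedMonoid.mk i x)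
    (mul_assoc : ∀ i j k (x : X i) (y : X j) (z : X k),
      GradedMonoid.mk (i + j + k) (mul (i + j) k (mul i j x y) z) =
        GradedMonoid.mk (i + (j + k)) (mul i (j + k) x (mul j k y z))) :
    IsGradedRing one mul := by
  let _ : GradedMonoid.GOne X := ⟨one⟩
  let _ : GradedMonoid.GMul X := ⟨fun {i j} x y => mul i j x y⟩
  let M : GradedMonoid.GMonoid X :=
    { one_mul := fun x => one_mul x.1 x.2
      mul_one := fun x => mul_one x.1 x.2
      mul_assoc := fun x y z => mul_assoc _ _ _ x.2 y.2 z.2 }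
  let _ : DirectSum.GRing X :=
    { M with
      mul_zero := fun x => map_zero (mul _ _ x)
      zero_mul := fun y => DFunLike.congr_fun (map_zero (mul _ _)) y
      mul_add := fun x y z => map_add (mul _ _ x) y z
      add_mul := fun x y z => DFunLike.congr_fun (map_add (mul _ _) x y) z
      natCast := fun n => n • one
      natCast_zero := zero_smul ℕ one
      natCast_succ := fun n => succ_nsmul one n
      intCast := fun n => n • one
      intCast_ofNat := fun n => natCast_zsmul one n
      intCast_negSucc_ofNat := fun n => by
        exact negSucc_zsmul one n }
  exact ⟨DirectSum.ring X, rfl, rfl, fun i j x y => DirectSum.of_mul_of x y⟩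

variable {C : Type u} [Category.{v} C] [Preadditive C] {A B D E : ChainComplex C ℕ}

lemma mk_yoneda {m n k : ℤ} (h : n + m = k) (y : CExt n A A) (x : CExt m A A) :
    GradedMonoid.mk (A := fun n => CExt n A A) (n + m) (yoneda rfl y x) =
      GradedMonoid.mk k (yoneda h y x) := by
  subst h
  rfl

lemma yoneda_ofHom_id {n : ℤ} (y : CExt n A B) : yoneda (add_zero n) y (ofHom (𝟙 A)) = y := by
  obtain ⟨φ, hφ, rfl⟩ := CExt.exists_mk y
  refine CExt.mk_eq_mk (comp_mem_almostCocycles (add_zero n) hφ (homFam_mem_almostCocycles _)) hφ ?_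
  rw [comp_homFam_id hφ.1, sub_self]
  exact zero_mem _

lemma ofHom_id_yoneda {n : ℤ} (z : CExt n A B) : yoneda (zero_add n) (ofHom (𝟙 B)) z = z := by
  obtain ⟨φ, hφ, rfl⟩ := CExt.exists_mk z
  refine CExt.mk_eq_mk (comp_mem_almostCocycles (zero_add n) (homFam_mem_almostCocycles _) hφ) hφ ?_
  rw [homFam_id_comp, sub_self]
  exact zero_mem _

lemma yoneda_assoc {a b c ab bc abc : ℤ} (hab : a + b = ab) (hbc : b + c = bc)
    (h : ab + c = abc) (h' : a + bc = abc) (x : CExt a D E) (y : CExt b B D) (z : CExt c A B) :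
    yoneda h (yoneda hab x y) z = yoneda h' x (yoneda hbc y z) := by
  obtain ⟨χ, hχ, rfl⟩ := CExt.exists_mk x
  obtain ⟨ψ, hψ, rfl⟩ := CExt.exists_mk y
  obtain ⟨φ, hφ, rfl⟩ := CExt.exists_mk z
  refine CExt.mk_eq_mk (comp_mem_almostCocycles h (comp_mem_almostCocycles hab hχ hψ) hφ)
    (comp_mem_almostCocycles h' hχ (comp_mem_almostCocycles hbc hψ hφ)) ?_
  rw [comp_assoc hab hχ.1, sub_self]
  exact zero_mem _

lemma isGradedRing_yoneda (A : ChainComplex C ℕ) :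
    IsGradedRing (X := fun n => CExt n A A) (ofHom (𝟙 A)) (fun _ _ => yoneda rfl) := by
  refine isGradedRing_of_assoc _ _ (fun i x => ?_) (fun i x => ?_) (fun i j k x y z => ?_)
  · rw [mk_yoneda (zero_add i), ofHom_id_yoneda]
  · rw [mk_yoneda (add_zero i), yoneda_ofHom_id]
  · rw [mk_yoneda (add_assoc i j k), yoneda_assoc rfl rfl (add_assoc i j k) rfl]

end GradedRing

/-! ### Tensor-exact resolutions -/

section Restriction

variable {C : Type u} [Category.{v} C] [Abelian C] {D : Type t} [Category.{w} D] [Abelian D]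
  (F : C ⥤ D) [PreservesFiniteLimits F] [PreservesFiniteColimits F]
  [F.PreservesProjectiveObjects] {R : C} (P : ProjectiveResolution R)

/-- If `F R` is projective, then `F` maps all syzygies of a resolution of `R` to projectives: the
sequences of which the resolution is spliced become split. -/
lemma projective_obj_syzygy [F.PreservesZeroMorphisms] (hR : Projective (F.obj R)) (k : ℕ) :
    Projective (F.obj (syzygy P k)) := by
  induction k with
  | zero => exact hR
  | succ k ih =>
    have hS := (syzygySeq_shortExact P k).map_of_exact F
    have : Projective ((syzygySeq P k).map F).X₃ := ih
    have : Projective ((syzygySeq P k).map F).X₂ := F.projective_obj (P.complex.X k)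
    let s := hS.splittingOfProjective
    exact (⟨_, s.r, s.f_r⟩ : Retract ((syzygySeq P k).map F).X₁ ((syzygySeq P k).map F).X₂).projective

variable [MonoidalCategory C] [MonoidalPreadditive C] [MonoidalCategory D] [MonoidalPreadditive D]
  [F.Monoidal] [F.Faithful]

/-- Tensor products keep the sequences of syzygies exact that are split after restriction along an
exact, faithful and monoidal functor. -/
lemma tensorExact_of_restrict (hR : Projective (F.obj R)) : TensorExact P := by
  have : F.Additive := F.additive_of_preserves_binary_products
  have hs : ∀ k, Nonempty ((syzygySeq P k).map F).Splitting := fun k => by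
    have : Projective ((syzygySeq P k).map F).X₃ := projective_obj_syzygy F P hR k
    exact ⟨((syzygySeq_shortExact P k).map_of_exact F).splittingOfProjective⟩
  have key : ∀ (G : C ⥤ C) [G.PreservesZeroMorphisms] (H : D ⥤ D) [H.Additive]
      (_ : F ⋙ H ≅ G ⋙ F) k, ((syzygySeq P k).map G).ShortExact := by
    intro G _ H _ i k
    obtain ⟨s⟩ := hs k
    have h1 : (((syzygySeq P k).map G).map F).ShortExact :=
      ShortComplex.shortExact_of_iso ((syzygySeq P k).mapNatIso i) (s.map H).shortExact
    have := h1.mono_f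
    have := h1.epi_g
    exact
      { exact := (ShortComplex.exact_map_iff_of_faithful _ F).1 h1.exact
        mono_f := F.mono_of_mono_map h1.mono_f
        epi_g := F.epi_of_epi_map h1.epi_g }
  exact ⟨fun X => key _ _ (Functor.Monoidal.commTensorLeft F X),
    fun X => key _ _ (Functor.Monoidal.commTensorRight F X)⟩

end Restriction

section Objects

variable {𝓔 : Type u} [Category.{v} 𝓔] [CartesianMonoidalCategory 𝓔] [BraidedCategory 𝓔]

instance faithful_restrict (R : 𝓔) [RingObj R] (G : 𝓔) [GrpObj G] :
    (GRMod.restrict R G).Faithful where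
  map_injective h := GRMod.Hom.ext h

end Objects

end CompletedExt

theorem lemma6p3 :
    -- unit and ring structure for cup products in complete cohomology
    (∀ {𝓔 : Type u} [Category.{v} 𝓔] [CartesianMonoidalCategory 𝓔] [BraidedCategory 𝓔]
        (R : 𝓔) [RingObj R] (G : 𝓔) [GrpObj G]
        [Abelian (RMod R)] [MonoidalCategory (RMod R)]
        [MonoidalPreadditive (RMod R)]
        [Abelian (GRMod R G)] [EnoughProjectives (GRMod R G)]
        [MonoidalCategory (GRMod R G)] [MonoidalPreadditive (GRMod R G)]
        (_ : ∀ P Q : GRMod R G, Projective P → Projective Q → Projective (P ⊗ Q))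
        [(GRMod.restrict R G).Monoidal]
        [PreservesFiniteLimits (GRMod.restrict R G)]
        [PreservesFiniteColimits (GRMod.restrict R G)]
        [(GRMod.restrict R G).PreservesProjectiveObjects]
        [Projective (RMod.regular R)]
        (e : GRMod.trivial R G ≅ 𝟙_ (GRMod R G))
        {o : ℕ → Bool} (ho : IsPath o)
        (P : ProjectiveResolution (GRMod.trivial R G)),
        FlatSyzygies P →
        -- the comparison maps that enter the definition of the cup products exist
        (∃ Δ : P.complex ⟶ tensorComplex P.complex P.complex,
          IsTensorLift P P P ((ρ_ _).inv ≫ _ ◁ e.inv) Δ) ∧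
        (∀ {M : GRMod R G} (Q : ProjectiveResolution M),
          FlatSyzygies Q →
          (∃ θ : pathComplex o Q P ⟶ Q.complex,
            IsPathLift o Q P Q ((M ◁ e.hom) ≫ (ρ_ M).hom) θ) ∧
          (∃ θ : pathComplex o P Q ⟶ Q.complex,
            IsPathLift o P Q Q ((e.hom ▷ M) ≫ (λ_ M).hom) θ)) ∧
        -- whatever the choices, the class of the identity is a two-sided unit
        ∀ Δ : P.complex ⟶ tensorComplex P.complex P.complex,
          IsTensorLift P P P ((ρ_ _).inv ≫ _ ◁ e.inv) Δ →
          (∀ {M : GRMod R G} (Q : ProjectiveResolution M),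
            FlatSyzygies Q →
            (∀ θ : pathComplex o Q P ⟶ Q.complex,
              IsPathLift o Q P Q ((M ◁ e.hom) ≫ (ρ_ M).hom) θ →
              ∀ (n : ℤ) (x : CExt n P.complex Q.complex),
                cup ho Q P Δ θ (add_zero n) x
                  (unitClass P) = x) ∧
            (∀ θ : pathComplex o P Q ⟶ Q.complex,
              IsPathLift o P Q Q ((e.hom ▷ M) ≫ (λ_ M).hom) θ →
              ∀ (n : ℤ) (x : CExt n P.complex Q.complex),
                cup ho P Q Δ θ (zero_add n)
                  (unitClass P) x = x)) ∧
          -- the complete cohomology of `G` with coefficients in `R` is a graded ring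
          ∀ θ : pathComplex o P P ⟶ P.complex,
            IsPathLift o P P P ((_ ◁ e.hom) ≫ (ρ_ _).hom) θ →
            IsGradedRing (X := fun n => CExt n P.complex P.complex)
              (unitClass P)
              (fun _ _ => cup ho P P Δ θ rfl)) ∧
    -- unit and ring structure for Yoneda products of completed Ext groups
    (∀ {C : Type w} [Category.{t} C] [Abelian C] [EnoughProjectives C] {A : C}
        (P : ProjectiveResolution A),
        (∀ {B : C} (Q : ProjectiveResolution B) (n : ℤ),
          (∀ y : CExt n P.complex Q.complex,
            yoneda (add_zero n) y (unitClass P) = y) ∧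
          (∀ z : CExt n Q.complex P.complex,
            yoneda (zero_add n) (unitClass P) z = z)) ∧
        IsGradedRing (X := fun n => CExt n P.complex P.complex)
          (unitClass P) (fun _ _ => yoneda rfl)) := by
  refine ⟨?_, ?_⟩
  · intro 𝓔 _ _ _ R _ G _ _ _ _ _ _ _ _ _ _ _ _ _ _ e o ho P hP
    have hR : Projective ((GRMod.restrict R G).obj (GRMod.trivial R G)) :=
      inferInstanceAs (Projective (RMod.regular R))
    have hT : TensorExact P := tensorExact_of_restrict (GRMod.restrict R G) P hR
    refine ⟨exists_isTensorLift hT e, fun Q hQ =>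
      ⟨exists_isPathLift hQ hP Q _, exists_isPathLift hP hQ Q _⟩, fun Δ hΔ =>
      ⟨fun Q _ => ⟨fun θ hθ n x => cup_unitClass hT ho hΔ hθ n x,
        fun θ hθ n x => unitClass_cup hT ho hΔ hθ n x⟩, fun θ hθ => ?_⟩⟩
    have h : (fun i j : ℤ => cup ho P P Δ θ (rfl : i + j = i + j)) = fun _ _ => yoneda rfl :=
      funext fun i => funext fun j => cup_eq_yoneda hT ho hΔ hθ rfl
    rw [h]
    exact isGradedRing_yoneda P.complex
  · intro C _ _ _ A P
    exact ⟨fun Q n => ⟨yoneda_ofHom_id, ofHom_id_yoneda⟩, isGradedRing_yoneda P.complex⟩
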